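/- Let $k$ be a field that is complete with respect to a non-trivial non-archimedean absolute value $|\cdot|$ (for example a local field or its completed algebraic closure), let $n\ge 2$ be an integer not divisible by the characteristic of $k$, and let $q\in k^\times$ with $|q|<1$. Assume that $k$ contains all $n$ of the $n$-th roots of $1$ and an $n$-th root of $q$. Let $E$ be the Tate curve $y^2+xy=x^3+a_4x+a_6$, where $$a_4=\sum_{m\ge1}(-5m^3)\frac{q^m}{1-q^m},\qquad a_6=\sum_{m\ge1}\Bigl(-\frac{5m^3+7m^5}{12}\Bigr)\frac{q^m}{1-q^m},$$ identified with $k^\times/q^{\mathbb Z}$ (and over every complete valued extension field $L$ of $k$ with $L^\times/q^{\mathbb Z}$) by the Tate uniformization $u\mapsto (x(u),y(u))$, $$x(u)=\sum_{m\in\mathbb Z}\frac{q^mu}{(1-q^mu)^2}-2\sum_{m\ge1}\frac{mq^m}{1-q^m},\qquad y(u)=\sum_{m\in\mathbb Z}\frac{(q^mu)^2}{(1-q^mu)^3}+\sum_{m\ge1}\frac{mq^m}{1-q^m}.$$ For a finite subgroup $G\subset E$ whose order is not divisible by the characteristic of $k$, a Jacobi function for $G$ is a non-zero rational function $f\in k(E)$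 with $\operatorname{div}(f)\ge-\sum_{g\in G}(g)$ for which there is a character $\chi\colon G\to k^\times$ such that $f(u+g)=\chi(g)f(u)$ for all $g\in G$. For $a\in\mathbb Z$ put $$\vartheta^n_a(u)=\prod_{\ell\ge1,\ \ell\equiv a\,(n)}(1-q^{\ell}u^n)\prod_{\ell\le0,\ \ell\equiv a\,(n)}(1-q^{-\ell}u^{-n}).$$ Then the function $$f(u)=\frac{\vartheta^n_{-1}(u)}{u\,\vartheta^n_0(u)}$$ is (the pullback under the uniformization of) a Jacobi function on $E$ for the subgroup $G\subset E$ consisting of the images of the $n$-th roots of $1$. Its zeros are exactly the images in $E$ of the $n$-th roots of $q$, and they are all simple. -/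

import Mathlib

open scoped Topology Polynomial Polynomial.Bivariate

universe u

noncomputable section

/-- The Tate curve `y² + xy = x³ + a₄ x + a₆` with parameter `q`. The integer
`5 m ^ 3 + 7 m ^ 5` is always divisible by `12`, so the division in `a₆` is exact. -/
def tateCurve {k : Type u} [NontriviallyNormedField k] (q : kˣ) : WeierstrassCurve k where
  a₁ := 1
  a₂ := 0
  a₃ := 0
  a₄ := ∑' m : ℕ+, (-(5 * (m : ℕ) ^ 3 : ℕ) : k) * ((q : k) ^ (m : ℕ) / (1 - (q : k) ^ (m : ℕ)))
  a₆ := ∑' m : ℕ+, (-((5 * (m : ℕ) ^ 3 + 7 * (m : ℕ) ^ 5) / 12 : ℕ) : k) *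
    ((q : k) ^ (m : ℕ) / (1 - (q : k) ^ (m : ℕ)))

/-- The field `k(E)` of rational functions on the Tate curve. -/
abbrev TateFunctionField {k : Type u} [NontriviallyNormedField k] (q : kˣ) : Type u :=
  (tateCurve q).toAffine.FunctionField

/-- The group `kˣ / q^ℤ` of `k`-points of the Tate curve. -/
abbrev TatePoints {k : Type u} [NontriviallyNormedField k] (q : kˣ) : Type u :=
  kˣ ⧸ Subgroup.zpowers q

/-- The `x`-coordinate of the point of the Tate curve which corresponds to the class of `u`
(for `u` not in `q^ℤ`). -/
def tateX {L : Type u} [NontriviallyNormedField L] (q u : L) : L :=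
  (∑' m : ℤ, q ^ m * u / (1 - q ^ m * u) ^ 2) -
    2 * ∑' m : ℕ+, ((m : ℕ) : L) * (q ^ (m : ℕ) / (1 - q ^ (m : ℕ)))

/-- The `y`-coordinate of the point of the Tate curve which corresponds to the class of `u`
(for `u` not in `q^ℤ`). -/
def tateY {L : Type u} [NontriviallyNormedField L] (q u : L) : L :=
  (∑' m : ℤ, (q ^ m * u) ^ 2 / (1 - q ^ m * u) ^ 3) +
    ∑' m : ℕ+, ((m : ℕ) : L) * (q ^ (m : ℕ) / (1 - q ^ (m : ℕ)))

/-- `f` is the rational function `F ∈ k(E)`, read as a meromorphic function of `u ∈ Lˣ` through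
the uniformization `Lˣ / q^ℤ ≃ E(L)`, `u ↦ (tateX q u, tateY q u)`: there are polynomials `A, B`
over `k` with `F = A(x, y) / B(x, y)` in the function field, and `f u` is the value of this
fraction at the point of `E` given by `u` wherever the denominator does not vanish. -/
def IsTatePullback {k : Type u} [NontriviallyNormedField k] (q : kˣ) (F : TateFunctionField q)
    (L : Type u) [NontriviallyNormedField L] [NormedAlgebra k L] (f : L → L) : Prop :=
  (∀ u : Lˣ, MeromorphicAt f (u : L)) ∧
  ∃ A B : k[X][Y],
    WeierstrassCurve.Affine.CoordinateRing.mk (tateCurve q).toAffine B ≠ 0 ∧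
    F = algebraMap (tateCurve q).toAffine.CoordinateRing (TateFunctionField q)
          (WeierstrassCurve.Affine.CoordinateRing.mk (tateCurve q).toAffine A) /
        algebraMap (tateCurve q).toAffine.CoordinateRing (TateFunctionField q)
          (WeierstrassCurve.Affine.CoordinateRing.mk (tateCurve q).toAffine B) ∧
    ∀ u : Lˣ, (∀ m : ℤ, (u : L) ≠ algebraMap k L q ^ m) →
      Polynomial.aevalAeval (tateX (algebraMap k L q) (u : L))
        (tateY (algebraMap k L q) (u : L)) B ≠ 0 →
      f u =
        Polynomial.aevalAeval (tateX (algebraMap k L q) (u : L))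
          (tateY (algebraMap k L q) (u : L)) A /
        Polynomial.aevalAeval (tateX (algebraMap k L q) (u : L))
          (tateY (algebraMap k L q) (u : L)) B

/-- `F` is a (generalized) Jacobi function on `E = kˣ / q^ℤ` for the finite subgroup `G`, belonging
to the character `χ`: the order of `G` is not divisible by the characteristic, `F` is a non-zero
rational function on `E` with `div F ≥ -∑_{g ∈ G} (g)`, and `F (u + g) = χ g * F u` for all
`g ∈ G`. The divisor is tested on the points of `E` over all complete valued extension fields `L`
of `k`, that is, on all geometric points. -/
def IsJacobiFunction {k : Type u} [NontriviallyNormedField k] (q : kˣ)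
    (G : Subgroup (TatePoints q)) (χ : G →* kˣ) (F : TateFunctionField q) : Prop :=
  Finite G ∧ (Nat.card G : k) ≠ 0 ∧ F ≠ 0 ∧
  ∀ (L : Type u) [NontriviallyNormedField L] [CompleteSpace L] [IsUltrametricDist L]
    [NormedAlgebra k L],
    ∃ f : L → L, IsTatePullback q F L f ∧
      (∀ u : Lˣ, ((-1 : ℤ) : WithTop ℤ) ≤ meromorphicOrderAt f (u : L)) ∧
      (∀ u : Lˣ, (∀ g : kˣ, (g : TatePoints q) ∈ G → (u : L) ≠ algebraMap k L g) →
        (0 : WithTop ℤ) ≤ meromorphicOrderAt f (u : L)) ∧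
      ∀ (g : kˣ) (hg : (g : TatePoints q) ∈ G) (u : Lˣ),
        ∀ᶠ w in 𝓝[≠] (u : L),
          f (algebraMap k L g * w) = algebraMap k L (χ ⟨(g : TatePoints q), hg⟩) * f w

/-- The function
`ϑⁿₐ(u) = ∏_{ℓ ≥ 1, ℓ ≡ a (n)} (1 - q^ℓ uⁿ) * ∏_{ℓ ≤ 0, ℓ ≡ a (n)} (1 - q^{-ℓ} u^{-n})`. -/
def vartheta {L : Type u} [NontriviallyNormedField L] (q : L) (n : ℕ) (a : ℤ) (u : L) : L :=
  (∏' l : {l : ℤ // 1 ≤ l ∧ l ≡ a [ZMOD n]}, (1 - q ^ (l : ℤ) * u ^ n)) *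
    ∏' l : {l : ℤ // l ≤ 0 ∧ l ≡ a [ZMOD n]}, (1 - q ^ (-(l : ℤ)) * (u⁻¹) ^ n)

/-- The function `f(u) = ϑⁿ₋₁(u) / (u ϑⁿ₀(u))`. -/
def thetaQuotient {L : Type u} [NontriviallyNormedField L] (q : L) (n : ℕ) (u : L) : L :=
  vartheta q n (-1) u / (u * vartheta q n 0 u)

/-- The subgroup of `kˣ / q^ℤ` of the images of the `n`-th roots of `1`. -/
def rootsOfUnityImage {k : Type u} [NontriviallyNormedField k] (q : kˣ) (n : ℕ) :
    Subgroup (TatePoints q) :=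
  (rootsOfUnity n k).map (QuotientGroup.mk' (Subgroup.zpowers q))

end

/-! Put `Q = q ^ n` and let `theta Q` be the theta function with simple zeros at the powers of `Q`.
The two factors of `thetaQuotient` are `theta Q (u ^ n / q)` and `theta Q (u ^ n)`, so zeros, poles
and transformation laws come from those of `theta`; the real issue is rationality, i.e. being a
fraction in `x(u)` and `y(u)` with coefficients in `k`.

Kronecker's identity (`theta_div_theta`) expands `theta Q (w / b) / theta Q w`, for `‖Q‖ < ‖b‖ < 1`,
as a constant times `∑ b ^ (-j) * Q ^ j w / (1 - Q ^ j w)`. Taking `b = q`, `w = u ^ n` and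
splitting each term over the `n`-th roots of unity (`sum_pow_mul_geom`) gives `f(u) = (c / n) * ∑ ζ
^ i * Z(ζ ^ i u)`, where `Z = lambertZeta` has simple poles at `q ^ ℤ` and `c ≠ 0`
(`thetaQuotient_eq_sum`). As the `ζ ^ i` sum to `0`, `Z(ζ ^ i u)` may be replaced by `Z(ζ ^ i u) -
Z(u)`, which the addition formula `lambertZeta_sub_mul_sumX_sub` writes as an expression linear in
`x(u)` and `y(u)` over `x(u) - x(ζ ^ i)`. The addition formula is a double sum of an elementary
identity, so the Weierstrass equation is never needed. The coefficients are convergent sums and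
products in `k`, hence serve every extension `L` at once.

Orders are read off from absolute values. On a circle `‖w‖ = r`, all factors of `theta` but one have
constant norm, so `‖theta Q w‖ = C * ‖1 - Q ^ m * w‖` (`norm_theta`). As `n ≠ 0` in `k`, `u ↦ u ^ n`
preserves simplicity of zeros away from `0`. -/

namespace TateUniformization

open Filter

/-! ### The Lambert zeta function and its addition formula -/

section

variable {K : Type u} [NontriviallyNormedField K]

/-- The geometric sum `t + t² + ⋯`. -/
noncomputable def geom (t : K) : K := t / (1 - t)

/-- The sum `t + 2 t² + 3 t³ + ⋯`. -/
noncomputable def geomX (t : K) : K := t / (1 - t) ^ 2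

/-- The sum `t² + 3 t³ + 6 t⁴ + ⋯`. -/
noncomputable def geomY (t : K) : K := t ^ 2 / (1 - t) ^ 3

/-- Partial fractions in `t`: a simple pole at `1 / c` and a double pole at `1`. Summed over `c = q
^ d * v` and `t = q ^ l * u`, this becomes the addition formula; at `c = 1` the poles collide and
`geom_mul_geomX_self` takes over. -/
theorem geom_mul_geomX {c t : K} (hc : c ≠ 1) (ht : t ≠ 1) (hct : c * t ≠ 1) :
    geom (c * t) * geomX t =
      geomX c * (geom (c * t) - geom t) + geom c * geomX t := by
  have h1 : 1 - c ≠ 0 := sub_ne_zero.2 hc.symm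
  have h2 : 1 - t ≠ 0 := sub_ne_zero.2 ht.symm
  have h3 : 1 - c * t ≠ 0 := sub_ne_zero.2 hct.symm
  unfold geom geomX
  field_simp
  ring

theorem geom_mul_geomX_self (t : K) : geom t * geomX t = geomY t := by
  unfold geom geomX geomY
  rw [div_mul_div_comm]
  ring_nf

theorem geom_eq_inv_sub_one {t : K} (ht : t ≠ 1) : geom t = 1 / (1 - t) - 1 := by
  have h2 : 1 - t ≠ 0 := sub_ne_zero.2 ht.symm
  unfold geom
  field_simp
  ring

theorem tendsto_zpow_mul_atTop {q : K} (hq : ‖q‖ < 1) (u : K) :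
    Tendsto (fun m : ℤ => q ^ m * u) atTop (𝓝 0) := by
  have h : Tendsto (fun m : ℤ => q ^ m) atTop (𝓝 0) := by
    rw [← tendsto_comp_val_Ici_atTop (a := (0 : ℤ))]
    have h1 := (tendsto_pow_atTop_nhds_zero_of_norm_lt_one hq)
    have h2 : Tendsto (fun m : Set.Ici (0 : ℤ) => (m : ℤ).toNat) atTop atTop := by
      refine tendsto_atTop.2 fun b => ?_
      filter_upwards [eventually_ge_atTop (⟨(b : ℤ), by simp⟩ : Set.Ici (0 : ℤ))] with m hm
      have : (b : ℤ) ≤ (m : ℤ) := hm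
      omega
    refine (h1.comp h2).congr fun m => ?_
    have : ((m : ℤ).toNat : ℤ) = m := Int.toNat_of_nonneg m.2
    simp only [Function.comp]
    rw [← zpow_natCast, this]
  simpa using h.mul_const u

theorem tendsto_zpow_mul_inv_atBot {q : K} (hq : ‖q‖ < 1) (u : K) :
    Tendsto (fun m : ℤ => (q ^ m * u)⁻¹) atBot (𝓝 0) := by
  have := (tendsto_zpow_mul_atTop hq u⁻¹).comp tendsto_neg_atBot_atTop
  refine this.congr fun m => ?_
  simp [mul_comm]

theorem continuousAt_geom_zero : ContinuousAt (geom : K → K) 0 := by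
  unfold geom
  exact continuousAt_id.div (by fun_prop) (by simp)

theorem continuousAt_geomX_zero : ContinuousAt (geomX : K → K) 0 := by
  unfold geomX
  exact continuousAt_id.div (by fun_prop) (by simp)

theorem continuousAt_geomY_zero : ContinuousAt (geomY : K → K) 0 := by
  unfold geomY
  exact (continuousAt_id.pow 2).div (by fun_prop) (by simp)

theorem geomX_inv (t : K) : geomX t⁻¹ = geomX t := by
  unfold geomX
  rcases eq_or_ne t 0 with rfl | h
  · simp
  rcases eq_or_ne t 1 with rfl | h1
  · simp
  rw [show t⁻¹ / (1 - t⁻¹) ^ 2 = t / (t - 1) ^ 2 by field_simp, ← neg_sub 1 t, neg_sq]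

/-- The regularized summand `geom (q ^ m * u)`, made to tend to `0` in both directions. -/
noncomputable def lambertTerm (q u : K) (m : ℤ) : K :=
  if 0 ≤ m then geom (q ^ m * u) else 1 / (1 - q ^ m * u)

/-- The quasi-periodic function with simple poles at `q ^ ℤ`, the analogue of the Weierstrass
zeta function. -/
noncomputable def lambertZeta (q u : K) : K := ∑' m : ℤ, lambertTerm q u m

theorem geom_eq_lambertTerm {q u : K} {m : ℤ} (h : q ^ m * u ≠ 1) :
    geom (q ^ m * u) = lambertTerm q u m - if m < 0 then 1 else 0 := by
  unfold lambertTerm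
  rcases lt_or_ge m 0 with hm | hm
  · simp [hm, not_le.2 hm, geom_eq_inv_sub_one h]
  · simp [hm, not_lt.2 hm]

theorem zpow_ne_one {q : K} (hq : ‖q‖ < 1) (hq0 : q ≠ 0) {d : ℤ} (hd : d ≠ 0) : q ^ d ≠ 1 := by
  intro h
  have h' : ‖q‖ ^ d = 1 := by rw [← norm_zpow, h, norm_one]
  rcases lt_or_gt_of_ne hd with hd | hd
  · exact (one_lt_zpow_of_neg₀ (norm_pos_iff.2 hq0) hq hd).ne' h'
  · exact (zpow_lt_one₀ (norm_pos_iff.2 hq0) hq hd).ne h'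

/-- The terms count, with sign, the integers between `-d` and `0`. They measure how far shifting the
index disturbs the regularization in `lambertTerm`. -/
theorem hasSum_indicator_shift (d : ℤ) :
    HasSum (fun l : ℤ => ((if l < 0 then 1 else 0) - if l + d < 0 then 1 else 0 : K)) d := by
  have step : HasSum
      (fun l : ℤ => ((if l < 0 then 1 else 0) - if l + 1 < 0 then 1 else 0 : K)) 1 := by
    convert hasSum_ite_eq (-1 : ℤ) (1 : K) using 2 with l
    split_ifs <;> first | omega | simp
  have shift : ∀ d : ℤ, HasSum
      (fun l : ℤ => ((if l + d < 0 then 1 else 0) - if l + (d + 1) < 0 then 1 else 0 : K)) 1 := by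
    intro d
    have := (Equiv.addRight d).hasSum_iff.2 step
    refine this.congr_fun fun l => ?_
    simp [add_assoc]
  induction d using Int.induction_on with
  | zero => simp
  | succ d ih =>
    have := ih.add (shift d)
    rw [← Int.cast_one (R := K), ← Int.cast_add] at this
    refine this.congr_fun fun l => ?_
    rw [Int.cast_one]
    abel
  | pred d ih =>
    have := ih.sub (shift (-d - 1))
    rw [← Int.cast_one (R := K), ← Int.cast_sub] at this
    refine this.congr_fun fun l => ?_
    rw [sub_add_cancel, Int.cast_one]
    abel

variable [CompleteSpace K] [IsUltrametricDist K]

/-- In a complete ultrametric group a family is summable as soon as it tends to `0` along the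
cofinite filter. -/
theorem summable_int {f : ℤ → K} (h1 : Tendsto f atTop (𝓝 0)) (h2 : Tendsto f atBot (𝓝 0)) :
    Summable f := by
  rw [NonarchimedeanAddGroup.summable_iff_tendsto_cofinite_zero, Int.cofinite_eq]
  exact h2.sup h1

theorem summable_geomX {q u : K} (hq : ‖q‖ < 1) : Summable fun m : ℤ => geomX (q ^ m * u) := by
  have h0 : geomX (0 : K) = 0 := by simp [geomX]
  refine summable_int ?_ ?_
  · have := continuousAt_geomX_zero.tendsto.comp (tendsto_zpow_mul_atTop hq u)
    rwa [h0] at this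
  · have := continuousAt_geomX_zero.tendsto.comp (tendsto_zpow_mul_inv_atBot hq u)
    rw [h0] at this
    exact this.congr fun m => geomX_inv _

theorem summable_intCast_mul_geomX {q u : K} (hq : ‖q‖ < 1) :
    Summable fun m : ℤ => (m : K) * geomX (q ^ m * u) := by
  have := summable_geomX (u := u) hq
  rw [NonarchimedeanAddGroup.summable_iff_tendsto_cofinite_zero] at *
  refine squeeze_zero_norm (fun m => ?_) (tendsto_zero_iff_norm_tendsto_zero.1 this)
  rw [norm_mul]
  exact mul_le_of_le_one_left (norm_nonneg _) (IsUltrametricDist.norm_intCast_le_one K m)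

theorem summable_geomY {q u : K} (hq : ‖q‖ < 1) : Summable fun m : ℤ => geomY (q ^ m * u) := by
  have h0 : geomY (0 : K) = 0 := by simp [geomY]
  refine summable_int ?_ ?_
  · have := continuousAt_geomY_zero.tendsto.comp (tendsto_zpow_mul_atTop hq u)
    rwa [h0] at this
  · have hc : ContinuousAt (fun t : K => t / (t - 1) ^ 3) 0 :=
      continuousAt_id.div (by fun_prop) (by norm_num)
    have := hc.tendsto.comp (tendsto_zpow_mul_inv_atBot hq u)
    rw [zero_div] at this
    refine this.congr fun m => ?_
    unfold geomY
    simp only [Function.comp]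
    generalize q ^ m * u = t
    rcases eq_or_ne t 0 with rfl | h
    · simp
    rcases eq_or_ne t 1 with rfl | h1
    · simp
    have h2 : 1 - t ≠ 0 := sub_ne_zero.2 h1.symm
    have : t⁻¹ - 1 = (1 - t) / t := by field_simp
    rw [this]
    field_simp

theorem summable_lambertTerm {q u : K} (hq : ‖q‖ < 1) (hq0 : q ≠ 0) (hu : u ≠ 0) :
    Summable (lambertTerm q u) := by
  refine summable_int ?_ ?_
  · have := continuousAt_geom_zero.tendsto.comp (tendsto_zpow_mul_atTop hq u)
    rw [show geom (0 : K) = 0 by simp [geom]] at this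
    refine this.congr' ?_
    filter_upwards [eventually_ge_atTop 0] with m hm
    simp [lambertTerm, hm]
  · have hc : ContinuousAt (fun t : K => t / (t - 1)) 0 :=
      continuousAt_id.div (by fun_prop) (by norm_num)
    have := hc.tendsto.comp (tendsto_zpow_mul_inv_atBot hq u)
    rw [zero_div] at this
    refine this.congr' ?_
    filter_upwards [eventually_lt_atBot 0] with m hm
    simp only [lambertTerm, not_le.2 hm, if_false, Function.comp]
    have ht : q ^ m * u ≠ 0 := mul_ne_zero (zpow_ne_zero _ hq0) hu
    generalize q ^ m * u = t at ht
    rw [show t⁻¹ - 1 = (1 - t) / t by field_simp]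
    field_simp

theorem hasSum_geom_sub_geom {q u v : K} (hq : ‖q‖ < 1) (hq0 : q ≠ 0) (hu : u ≠ 0) (hv : v ≠ 0)
    (hu1 : ∀ m : ℤ, q ^ m * u ≠ 1) (hv1 : ∀ m : ℤ, q ^ m * v ≠ 1) :
    HasSum (fun m : ℤ => geom (q ^ m * v) - geom (q ^ m * u))
      (lambertZeta q v - lambertZeta q u) := by
  refine ((summable_lambertTerm hq hq0 hv).hasSum.sub
    (summable_lambertTerm hq hq0 hu).hasSum).congr_fun ?_
  intro m
  rw [geom_eq_lambertTerm (hu1 m), geom_eq_lambertTerm (hv1 m)]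
  ring

/-- A telescoping sum: `geom (q ^ l * u)` tends to `0` as `l → ∞` and to `-1` as `l → -∞`, so each
unit of shift contributes `1`. -/
theorem hasSum_geom_shift {q u : K} (hq : ‖q‖ < 1) (hq0 : q ≠ 0) (hu : u ≠ 0)
    (hu1 : ∀ m : ℤ, q ^ m * u ≠ 1) (d : ℤ) :
    HasSum (fun l : ℤ => geom (q ^ (l + d) * u) - geom (q ^ l * u)) d := by
  have h1 := (summable_lambertTerm hq hq0 hu).hasSum
  have h2 := (Equiv.addRight d).hasSum_iff.2 h1
  have h3 := (h2.sub h1).add (hasSum_indicator_shift (K := K) d)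
  rw [sub_self, zero_add] at h3
  refine h3.congr_fun fun l => ?_
  rw [geom_eq_lambertTerm (hu1 l), geom_eq_lambertTerm (hu1 _)]
  simp only [Function.comp, Equiv.coe_addRight]
  ring

/-- `∑ m ∈ ℤ, (q ^ m * u) / (1 - q ^ m * u) ^ 2`. -/
noncomputable def sumX (q u : K) : K := ∑' m : ℤ, geomX (q ^ m * u)

/-- `∑ m ∈ ℤ, (q ^ m * u) ^ 2 / (1 - q ^ m * u) ^ 3`. -/
noncomputable def sumY (q u : K) : K := ∑' m : ℤ, geomY (q ^ m * u)

/-- The coefficient of `sumX` in the addition formula `lambertZeta_sub_mul_sumX_sub`. -/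
noncomputable def additionSlope (q v : K) : K :=
  ∑' d : ℤ, (geom (q ^ d * v) - geom (q ^ d))

/-- The constant in the addition formula `lambertZeta_sub_mul_sumX_sub`. -/
noncomputable def additionConst (q v : K) : K :=
  ∑' d : ℤ, (d : K) * (geomX (q ^ d * v) - geomX (q ^ d))

theorem summable_additionSlope {q v : K} (hq : ‖q‖ < 1) (hq0 : q ≠ 0) (hv : v ≠ 0)
    (hv1 : ∀ m : ℤ, q ^ m * v ≠ 1) :
    Summable fun d : ℤ => geom (q ^ d * v) - geom (q ^ d) := by
  refine ((summable_lambertTerm hq hq0 hv).sub (summable_lambertTerm hq hq0 one_ne_zero)).congr ?_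
  intro d
  rw [geom_eq_lambertTerm (hv1 d)]
  unfold lambertTerm
  rcases lt_or_ge d 0 with hd | hd
  · have : q ^ d ≠ 1 := zpow_ne_one hq hq0 hd.ne
    simp [not_le.2 hd, hd, geom_eq_inv_sub_one this]
  · simp [hd, not_lt.2 hd]

theorem summable_additionConst {q v : K} (hq : ‖q‖ < 1) :
    Summable fun d : ℤ => (d : K) * (geomX (q ^ d * v) - geomX (q ^ d)) := by
  refine ((summable_intCast_mul_geomX (u := v) hq).sub
    (summable_intCast_mul_geomX (u := 1) hq)).congr fun d => ?_
  rw [mul_one]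
  ring

/-- The addition formula: `ζ (u v) - ζ u` is a rational function of `x u` and `y u`. -/
theorem lambertZeta_sub_mul_sumX_sub {q u v : K} (hq : ‖q‖ < 1) (hq0 : q ≠ 0) (hu : u ≠ 0)
    (hv : v ≠ 0) (hu1 : ∀ m : ℤ, q ^ m * u ≠ 1) (hv1 : ∀ m : ℤ, q ^ m * v ≠ 1)
    (huv1 : ∀ m : ℤ, q ^ m * (v * u) ≠ 1) :
    (lambertZeta q (v * u) - lambertZeta q u) * (sumX q u - sumX q v) =
      -sumY q u + additionSlope q v * sumX q u + additionConst q v := by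
  have : NonarchimedeanRing K :=
    { is_nonarchimedean := NonarchimedeanAddGroup.is_nonarchimedean }
  set R := lambertZeta q (v * u) - lambertZeta q u with hR
  have huv : v * u ≠ 0 := mul_ne_zero hv hu
  have hRsum := hasSum_geom_sub_geom hq hq0 hu huv hu1 huv1
  have hX := (summable_geomX (u := u) hq).hasSum
  -- the double sum, indexed by `(d, l)`
  let e : ℤ × ℤ ≃ ℤ × ℤ :=
    { toFun := fun p => (p.2 + p.1, p.2)
      invFun := fun p => (p.1 - p.2, p.2)
      left_inv := fun p => by simp
      right_inv := fun p => by simp }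
  have hT := e.hasSum_iff.2 (hRsum.mul_of_nonarchimedean hX)
  have hT2 := (summable_additionSlope hq hq0 hv hv1).hasSum.mul_of_nonarchimedean hX
  have hT3 : HasSum (fun p : ℤ × ℤ => if p.1 = 0 then geomY (q ^ p.2 * u) else 0) (sumY q u) := by
    have h := (summable_geomY (u := u) hq).hasSum
    have hinj : Function.Injective (fun l : ℤ => ((0 : ℤ), l)) := fun a b h => by simpa using h
    refine (hinj.hasSum_iff ?_).1 ?_
    · rintro ⟨d, l⟩ hd
      have : d ≠ 0 := fun h => hd ⟨l, by simp [h]⟩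
      simp [this]
    · exact h.congr_fun fun l => by simp
  have hT1 := (hT.sub hT2).add hT3
  -- The difference of `geom_mul_geomX` for `c = q ^ d * v` and for `c = q ^ d`, with `t = q ^ l *
  -- u`. The right side is what the products of series sum; the left side is suited to summing over
  -- `l` first.
  have key : ∀ p : ℤ × ℤ,
      geomX (q ^ p.1 * v) * (geom (q ^ (p.2 + p.1) * (v * u)) - geom (q ^ p.2 * u)) -
        geomX (q ^ p.1) * (geom (q ^ (p.2 + p.1) * u) - geom (q ^ p.2 * u)) =
      (geom (q ^ (p.2 + p.1) * (v * u)) - geom (q ^ (p.2 + p.1) * u)) * geomX (q ^ p.2 * u) -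
        (geom (q ^ p.1 * v) - geom (q ^ p.1)) * geomX (q ^ p.2 * u) +
        if p.1 = 0 then geomY (q ^ p.2 * u) else 0 := by
    rintro ⟨d, l⟩
    have e1 : q ^ (l + d) * (v * u) = q ^ d * v * (q ^ l * u) := by
      rw [zpow_add₀ hq0]; ring
    have e2 : q ^ (l + d) * u = q ^ d * (q ^ l * u) := by
      rw [zpow_add₀ hq0]; ring
    have h1 := geom_mul_geomX (hv1 d) (hu1 l) (by rw [← e1]; exact huv1 _)
    simp only [e1, e2]
    rcases eq_or_ne d 0 with rfl | hd
    · have h0 : geom (1 : K) = 0 := by simp [geom]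
      have h2 := geom_mul_geomX_self (q ^ l * u)
      simp only [zpow_zero, one_mul, if_true, h0] at h1 ⊢
      linear_combination -h1 + h2
    · have h2 := geom_mul_geomX (zpow_ne_one hq hq0 hd) (hu1 l) (by rw [← e2]; exact hu1 _)
      simp only [hd, if_false]
      linear_combination -h1 + h2
  have hT1' := hT1.congr_fun key
  -- For fixed `d` the first bracket is a reindexed copy of the series of `R` plus a telescoping sum
  -- `d`; the second is the telescoping sum alone.
  have hfib : ∀ d : ℤ, HasSum (fun l : ℤ =>
      geomX (q ^ d * v) * (geom (q ^ (l + d) * (v * u)) - geom (q ^ l * u)) -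
        geomX (q ^ d) * (geom (q ^ (l + d) * u) - geom (q ^ l * u)))
      (geomX (q ^ d * v) * (R + d) - geomX (q ^ d) * d) := by
    intro d
    have hs := hasSum_geom_shift hq hq0 hu hu1 d
    have hr := (Equiv.addRight d).hasSum_iff.2 hRsum
    refine HasSum.sub (HasSum.mul_left _ ?_) (hs.mul_left _)
    refine (hr.add hs).congr_fun fun l => ?_
    simp
  have htot := hT1'.prod_fiberwise hfib
  have htot2 : HasSum (fun d : ℤ => geomX (q ^ d * v) * (R + d) - geomX (q ^ d) * d)
      (sumX q v * R + additionConst q v) := by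
    refine (((summable_geomX (u := v) hq).hasSum.mul_right R).add
      (summable_additionConst (v := v) hq).hasSum).congr_fun fun d => ?_
    ring
  have := htot.unique htot2
  have h3 : R * sumX q u - additionSlope q v * sumX q u + sumY q u
    = sumX q v * R + additionConst q v := this
  linear_combination h3

end

/-! ### The theta function: product, absolute value and zeros -/

section

variable {K : Type u} [NontriviallyNormedField K]

/-- The theta function `∏_{j ≥ 1} (1 - Q ^ j * w) * ∏_{j ≥ 0} (1 - Q ^ j / w)`. -/
noncomputable def theta (Q w : K) : K :=
  (∏' j : ℕ, (1 - Q ^ (j + 1) * w)) * ∏' j : ℕ, (1 - Q ^ j * w⁻¹)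

/-- Because `c < n`, the indices congruent to `-c` are exactly `n * (j + 1) - c` (positive) and `-(n
* j + c)` (nonpositive) for `j ≥ 0`. -/
theorem vartheta_eq_theta {q u : K} (hq0 : q ≠ 0) {n : ℕ} {c : ℕ} (hc : c < n) :
    vartheta q n (-(c : ℤ)) u = theta (q ^ n) (u ^ n / q ^ c) := by
  have hn : (0 : ℤ) < n := by omega
  have hc' : (c : ℤ) < n := by exact_mod_cast hc
  unfold vartheta theta
  congr 1
  · let g : ℕ → {l : ℤ // 1 ≤ l ∧ l ≡ -(c : ℤ) [ZMOD n]} := fun j =>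
      ⟨n * (j + 1) - c, by nlinarith,
        Int.modEq_iff_dvd.2 ⟨-(j + 1), by ring⟩⟩
    have hg : Function.Bijective g := by
      constructor
      · intro a b hab
        have h : (n : ℤ) * (a + 1) - c = n * (b + 1) - c := congrArg Subtype.val hab
        have h' : (n : ℤ) * a = n * b := by linarith
        exact_mod_cast mul_left_cancel₀ hn.ne' h'
      · rintro ⟨l, hl, hla⟩
        obtain ⟨d, hd⟩ := Int.modEq_iff_dvd.1 hla
        have hd0 : d < 0 := by
          by_contra h
          nlinarith
        refine ⟨(-d - 1).toNat, Subtype.ext ?_⟩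
        have : (((-d - 1).toNat : ℕ) : ℤ) = -d - 1 := Int.toNat_of_nonneg (by omega)
        simp only [g, this]
        linear_combination hd
    rw [← (Equiv.ofBijective g hg).tprod_eq]
    refine tprod_congr fun j => ?_
    simp only [Equiv.ofBijective_apply, g]
    rw [zpow_sub₀ hq0, zpow_natCast,
      show (n : ℤ) * (j + 1) = ((n * (j + 1) : ℕ) : ℤ) by push_cast; ring, zpow_natCast, pow_mul]
    ring
  · let g : ℕ → {l : ℤ // l ≤ 0 ∧ l ≡ -(c : ℤ) [ZMOD n]} := fun j =>
      ⟨-(n * j + c), by nlinarith, Int.modEq_iff_dvd.2 ⟨j, by ring⟩⟩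
    have hg : Function.Bijective g := by
      constructor
      · intro a b hab
        have h : -((n : ℤ) * a + c) = -(n * b + c) := congrArg Subtype.val hab
        have h' : (n : ℤ) * a = n * b := by linarith
        exact_mod_cast mul_left_cancel₀ hn.ne' h'
      · rintro ⟨l, hl, hla⟩
        obtain ⟨d, hd⟩ := Int.modEq_iff_dvd.1 hla
        have hd0 : 0 ≤ d := by
          by_contra h
          nlinarith
        refine ⟨d.toNat, Subtype.ext ?_⟩
        have : ((d.toNat : ℕ) : ℤ) = d := Int.toNat_of_nonneg hd0
        simp only [g, this]
        linear_combination hd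
    rw [← (Equiv.ofBijective g hg).tprod_eq]
    refine tprod_congr fun j => ?_
    simp only [Equiv.ofBijective_apply, g]
    rw [neg_neg, show (n : ℤ) * j + c = ((n * j + c : ℕ) : ℤ) by push_cast; ring,
      zpow_natCast, pow_add, pow_mul, inv_div, inv_pow]
    ring

theorem thetaQuotient_eq {q : K} (hq0 : q ≠ 0) {n : ℕ} (hn : 2 ≤ n) (u : K) :
    thetaQuotient q n u = theta (q ^ n) (u ^ n / q) / (u * theta (q ^ n) (u ^ n)) := by
  have h1 := vartheta_eq_theta (u := u) hq0 (show 1 < n by omega)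
  have h0 := vartheta_eq_theta (u := u) hq0 (show 0 < n by omega)
  simp only [Nat.cast_one, pow_one, Nat.cast_zero, neg_zero, pow_zero, div_one] at h1 h0
  rw [thetaQuotient, h1, h0]

/-- After multiplication by `(u - x) ^ (-e)` the norm is the nonzero constant `C`, which excludes
both a zero and a pole. -/
theorem meromorphicOrderAt_eq_of_norm {f : K → K} {x : K} (hf : MeromorphicAt f x) {C : ℝ}
    (hC : 0 < C) {e : ℤ} (h : ∀ᶠ u in 𝓝[≠] x, ‖f u‖ = C * ‖u - x‖ ^ e) :
    meromorphicOrderAt f x = e := by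
  have hm : MeromorphicAt (fun u => (u - x) ^ (-e)) x := by fun_prop
  have hg : MeromorphicAt (fun u => f u * (u - x) ^ (-e)) x := by fun_prop
  have hn : Tendsto (fun u => ‖f u * (u - x) ^ (-e)‖) (𝓝[≠] x) (𝓝 C) := by
    refine tendsto_const_nhds.congr' ?_
    filter_upwards [h, self_mem_nhdsWithin] with u hu hux
    have : ‖u - x‖ ≠ 0 := norm_ne_zero_iff.2 (sub_ne_zero.2 hux)
    rw [norm_mul, hu, norm_zpow, mul_assoc, ← zpow_add₀ this, add_neg_cancel, zpow_zero, mul_one]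
  have h0 : meromorphicOrderAt (fun u => f u * (u - x) ^ (-e)) x = 0 := by
    rcases lt_trichotomy (meromorphicOrderAt (fun u => f u * (u - x) ^ (-e)) x) 0 with h | h | h
    · have := (tendsto_cobounded_iff_meromorphicOrderAt_neg hg).2 h
      exact absurd hn
        (not_tendsto_nhds_of_tendsto_atTop (tendsto_norm_atTop_iff_cobounded.2 this) _)
    · exact h
    · have := ((tendsto_zero_iff_meromorphicOrderAt_pos hg).2 h).norm
      rw [norm_zero] at this
      exact absurd (tendsto_nhds_unique hn this) hC.ne'
  have hz : meromorphicOrderAt (fun u => (u - x) ^ (-e)) x = ((-e : ℤ) : WithTop ℤ) :=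
    fun_meromorphicOrderAt_zpow_id_sub_const
  rw [fun_meromorphicOrderAt_mul hf hm, hz] at h0
  cases ho : meromorphicOrderAt f x with
  | top => rw [ho] at h0; simp at h0
  | coe d =>
    rw [ho] at h0
    have : d + -e = 0 := by exact_mod_cast h0
    exact_mod_cast (by omega : d = e)

theorem multipliable_one_sub [CompleteSpace K] {Q : K} (hQ : ‖Q‖ < 1) (x : K) :
    Multipliable fun j : ℕ => 1 - Q ^ j * x := by
  simp only [sub_eq_add_neg]
  refine multipliable_one_add_of_summable ?_
  simp only [norm_neg, norm_mul, norm_pow]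
  exact (summable_geometric_of_lt_one (norm_nonneg _) hQ).mul_right _

theorem multipliable_one_sub_succ [CompleteSpace K] {Q : K} (hQ : ‖Q‖ < 1) (x : K) :
    Multipliable fun j : ℕ => 1 - Q ^ (j + 1) * x := by
  refine (multipliable_one_sub hQ (Q * x)).congr fun j => ?_
  ring

variable [IsUltrametricDist K]

theorem norm_one_sub_eq_one {x : K} (hx : ‖x‖ < 1) : ‖1 - x‖ = 1 := by
  rw [sub_eq_add_neg, IsUltrametricDist.norm_add_eq_max_of_norm_ne_norm, norm_neg, norm_one,
    max_eq_left hx.le]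
  rw [norm_neg, norm_one]
  exact hx.ne'

/-- By the ultrametric inequality the norm is locally constant away from `0`. -/
theorem eventually_norm_eq {f : K → K} {x : K} (hf : ContinuousAt f x) (hx : f x ≠ 0) :
    ∀ᶠ y in 𝓝 x, ‖f y‖ = ‖f x‖ := by
  filter_upwards [Metric.tendsto_nhds.1 hf.tendsto ‖f x‖ (norm_pos_iff.2 hx)] with y hy
  rw [dist_eq_norm] at hy
  rw [← sub_add_cancel (f y) (f x),
    IsUltrametricDist.norm_add_eq_max_of_norm_ne_norm hy.ne, max_eq_right hy.le]

/-- The cofactor of `y - x` in `y ^ n - x ^ n` equals `n * x ^ (n - 1)` at `y = x`, so its norm is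
constant nearby. This is where `n ≠ 0` in the field gives simple zeros and poles. -/
theorem eventually_norm_pow_sub_pow {n : ℕ} (hn : (n : K) ≠ 0) {x : K} (hx : x ≠ 0) :
    ∃ C : ℝ, 0 < C ∧ ∀ᶠ y in 𝓝 x, ‖y ^ n - x ^ n‖ = C * ‖y - x‖ := by
  have hval : ∑ i ∈ Finset.range n, x ^ i * x ^ (n - 1 - i) = n * x ^ (n - 1) := by
    rw [Finset.sum_congr rfl (g := fun _ => x ^ (n - 1)), Finset.sum_const, Finset.card_range,
      nsmul_eq_mul]
    intro i hi
    rw [← pow_add]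
    congr 1
    have := Finset.mem_range.1 hi
    omega
  have hne : ∑ i ∈ Finset.range n, x ^ i * x ^ (n - 1 - i) ≠ 0 := by
    rw [hval]
    exact mul_ne_zero hn (pow_ne_zero _ hx)
  have hc : ContinuousAt (fun y => ∑ i ∈ Finset.range n, y ^ i * x ^ (n - 1 - i)) x := by fun_prop
  refine ⟨_, norm_pos_iff.2 hne, (eventually_norm_eq hc hne).mono fun y hy => ?_⟩
  rw [← geom_sum₂_mul, norm_mul, hy]

variable [CompleteSpace K]

theorem norm_tprod_one_sub {Q x : K} (hQ : ‖Q‖ < 1) (hx : ‖x‖ < 1) :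
    ‖∏' j : ℕ, (1 - Q ^ j * x)‖ = 1 := by
  rw [(multipliable_one_sub hQ x).norm_tprod, tprod_congr (g := fun _ => 1), tprod_one]
  intro j
  refine norm_one_sub_eq_one ?_
  rw [norm_mul, norm_pow]
  exact (mul_le_of_le_one_left (norm_nonneg _) (pow_le_one₀ (norm_nonneg _) hQ.le)).trans_lt hx

/-- Replacing `w` by `Q * w` removes the factor `1 - Q * w` from one product and adds `1 - (Q *
w)⁻¹` to the other. -/
theorem theta_mul {Q w : K} (hQ : ‖Q‖ < 1) (hQ0 : Q ≠ 0) (hw : w ≠ 0) :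
    theta Q (Q * w) = -(Q * w)⁻¹ * theta Q w := by
  have h1 : ∏' j : ℕ, (1 - Q ^ (j + 1) * w) =
      (1 - Q * w) * ∏' j : ℕ, (1 - Q ^ (j + 1) * (Q * w)) := by
    rw [tprod_eq_zero_mul']
    · simp only [zero_add, pow_one]
      congr 1
      exact tprod_congr fun j => by ring
    · refine (multipliable_one_sub_succ hQ (Q * w)).congr fun j => ?_
      ring
  have h2 : ∏' j : ℕ, (1 - Q ^ j * (Q * w)⁻¹) =
      (1 - (Q * w)⁻¹) * ∏' j : ℕ, (1 - Q ^ j * w⁻¹) := by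
    have e : ∀ j : ℕ, 1 - Q ^ (j + 1) * (Q * w)⁻¹ = 1 - Q ^ j * w⁻¹ := fun j => by
      rw [pow_succ, mul_inv, mul_assoc, mul_inv_cancel_left₀ hQ0]
    rw [tprod_eq_zero_mul']
    · simp only [pow_zero, one_mul, e]
    · simp only [e]
      exact multipliable_one_sub hQ _
  unfold theta
  rw [h1, h2]
  have : 1 - (Q * w)⁻¹ = -(Q * w)⁻¹ * (1 - Q * w) := by field_simp; ring
  rw [this]
  ring

/-- In this fundamental annulus every factor other than `1 - w⁻¹` has the form `1 - z` with `‖z‖ <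
1`, hence norm `1`. -/
theorem norm_theta_fundamental {Q w : K} (hQ : ‖Q‖ < 1) (h1 : ‖Q‖ < ‖w‖) (h2 : ‖w‖ ≤ 1) :
    ‖theta Q w‖ = ‖1 - w⁻¹‖ := by
  have hw : 0 < ‖w‖ := (norm_nonneg _).trans_lt h1
  have e1 : ∏' j : ℕ, (1 - Q ^ (j + 1) * w) = ∏' j : ℕ, (1 - Q ^ j * (Q * w)) :=
    tprod_congr fun j => by ring
  have e2 : ∏' j : ℕ, (1 - Q ^ j * w⁻¹) = (1 - w⁻¹) * ∏' j : ℕ, (1 - Q ^ j * (Q * w⁻¹)) := by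
    have e : ∀ j : ℕ, 1 - Q ^ (j + 1) * w⁻¹ = 1 - Q ^ j * (Q * w⁻¹) := fun j => by ring
    rw [tprod_eq_zero_mul']
    · simp only [pow_zero, one_mul, e]
    · exact multipliable_one_sub_succ hQ _
  rw [theta, e1, e2, norm_mul, norm_mul, norm_tprod_one_sub hQ, norm_tprod_one_sub hQ, one_mul,
    mul_one]
  · rw [norm_mul, norm_inv, ← div_eq_mul_inv, div_lt_one hw]
    exact h1
  · rw [norm_mul]
    exact (mul_le_of_le_one_right (norm_nonneg _) h2).trans_lt hQ

theorem norm_theta_zpow_mul {Q : K} (hQ : ‖Q‖ < 1) (hQ0 : Q ≠ 0) {r : ℝ} (hr : 0 < r) (m : ℤ) :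
    ∃ C : ℝ, 0 < C ∧ ∀ w : K, ‖w‖ = r → ‖theta Q (Q ^ m * w)‖ = C * ‖theta Q w‖ := by
  have hQn : 0 < ‖Q‖ := norm_pos_iff.2 hQ0
  have step : ∀ m : ℤ, ∀ w : K, ‖w‖ = r →
      ‖theta Q (Q ^ (m + 1) * w)‖ = (‖Q‖ ^ (m + 1) * r)⁻¹ * ‖theta Q (Q ^ m * w)‖ := by
    intro m w hw
    have hw0 : w ≠ 0 := norm_pos_iff.1 (hw ▸ hr)
    have e : Q ^ (m + 1) * w = Q * (Q ^ m * w) := by rw [zpow_add_one₀ hQ0]; ring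
    rw [e, theta_mul hQ hQ0 (mul_ne_zero (zpow_ne_zero _ hQ0) hw0), ← e, norm_mul, norm_neg,
      norm_inv, norm_mul, norm_zpow, hw]
  induction m using Int.induction_on with
  | zero => exact ⟨1, one_pos, fun w _ => by simp⟩
  | succ m ih =>
    obtain ⟨C, hC, h⟩ := ih
    refine ⟨(‖Q‖ ^ ((m : ℤ) + 1) * r)⁻¹ * C, by positivity, fun w hw => ?_⟩
    rw [step _ w hw, h w hw, mul_assoc]
  | pred m ih =>
    obtain ⟨C, hC, h⟩ := ih
    refine ⟨‖Q‖ ^ (-(m : ℤ)) * r * C, by positivity, fun w hw => ?_⟩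
    have := step (-m - 1) w hw
    rw [sub_add_cancel, h w hw] at this
    rw [mul_assoc, this, mul_inv_cancel_left₀]
    positivity

/-- A power of `Q` moves the circle through `w₀` into the fundamental annulus, and the functional
equation changes the norm only by a factor constant on the circle. Location and simplicity of all
zeros follow. -/
theorem norm_theta {Q w₀ : K} (hQ : ‖Q‖ < 1) (hQ0 : Q ≠ 0) (hw₀ : w₀ ≠ 0) :
    ∃ C : ℝ, 0 < C ∧ ∃ m : ℤ, ∀ w : K, ‖w‖ = ‖w₀‖ → ‖theta Q w‖ = C * ‖1 - Q ^ m * w‖ := by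
  have hQn : 0 < ‖Q‖ := norm_pos_iff.2 hQ0
  have hwn : 0 < ‖w₀‖ := norm_pos_iff.2 hw₀
  -- Here `‖Q‖ ^ (-m) < ‖w₀‖ ≤ ‖Q‖ ^ (-(m + 1))`, so `Q ^ (m + 1) * w₀` lies in the annulus.
  obtain ⟨m, hm1, hm2⟩ := exists_mem_Ioc_zpow hwn ((one_lt_inv₀ hQn).2 hQ)
  rw [inv_zpow'] at hm1 hm2
  set z := Q ^ (m + 1) with hz
  have hz0 : z ≠ 0 := zpow_ne_zero _ hQ0
  have hzn : 0 < ‖z‖ := norm_pos_iff.2 hz0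
  have b2 : ‖z‖ * ‖w₀‖ ≤ 1 := by
    have : ‖z‖ * ‖Q‖ ^ (-(m + 1)) = 1 := by
      rw [hz, norm_zpow, ← zpow_add₀ hQn.ne', add_neg_cancel, zpow_zero]
    rw [← this]
    exact mul_le_mul_of_nonneg_left hm2 hzn.le
  have b1 : ‖Q‖ < ‖z‖ * ‖w₀‖ := by
    have : ‖z‖ * ‖Q‖ ^ (-m) = ‖Q‖ := by
      rw [hz, norm_zpow, ← zpow_add₀ hQn.ne']
      simp
    nth_rewrite 1 [← this]
    exact mul_lt_mul_of_pos_left hm1 hzn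
  obtain ⟨C, hC, h⟩ := norm_theta_zpow_mul hQ hQ0 (hQn.trans b1) (-(m + 1))
  refine ⟨C * (‖z‖ * ‖w₀‖)⁻¹, by positivity, m + 1, fun w hw => ?_⟩
  have hzw : ‖z * w‖ = ‖z‖ * ‖w₀‖ := by rw [norm_mul, hw]
  have hzw0 : z * w ≠ 0 := norm_pos_iff.1 (by rw [hzw]; positivity)
  have e : Q ^ (-(m + 1)) * (z * w) = w := by
    rw [zpow_neg, ← hz, inv_mul_cancel_left₀ hz0]
  have e2 : 1 - (z * w)⁻¹ = -((z * w)⁻¹ * (1 - z * w)) := by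
    rw [mul_sub, inv_mul_cancel₀ hzw0, mul_one, neg_sub]
  have h2 := h (z * w) hzw
  rw [e, norm_theta_fundamental (w := z * w) hQ (hzw ▸ b1) (hzw ▸ b2), e2, norm_neg,
    norm_mul, norm_inv, hzw] at h2
  rw [h2, mul_assoc]

theorem theta_eq_zero_iff {Q w : K} (hQ : ‖Q‖ < 1) (hQ0 : Q ≠ 0) (hw : w ≠ 0) :
    theta Q w = 0 ↔ ∃ m : ℤ, w = Q ^ m := by
  constructor
  · intro h
    obtain ⟨C, hC, m, hm⟩ := norm_theta hQ hQ0 hw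
    have h1 := hm w rfl
    rw [h, norm_zero, zero_eq_mul, or_iff_right hC.ne', norm_eq_zero, sub_eq_zero] at h1
    refine ⟨-m, ?_⟩
    rw [zpow_neg]
    exact eq_inv_of_mul_eq_one_right h1.symm
  · rintro ⟨m, rfl⟩
    obtain ⟨C, hC, h⟩ := norm_theta_zpow_mul hQ hQ0 one_pos m
    have h1 := h 1 norm_one
    rw [norm_theta_fundamental hQ (by rwa [norm_one]) norm_one.le, inv_one, sub_self, norm_zero,
      mul_zero, mul_one, norm_eq_zero] at h1
    exact h1

theorem eventually_norm_theta_of_ne {Q w₀ : K} (hQ : ‖Q‖ < 1) (hQ0 : Q ≠ 0) (hw₀ : w₀ ≠ 0)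
    (h : theta Q w₀ ≠ 0) : ∀ᶠ w in 𝓝 w₀, ‖theta Q w‖ = ‖theta Q w₀‖ := by
  obtain ⟨C, hC, m, hm⟩ := norm_theta hQ hQ0 hw₀
  have hne : 1 - Q ^ m * w₀ ≠ 0 := by
    intro h0
    have h1 := hm w₀ rfl
    rw [h0, norm_zero, mul_zero, norm_eq_zero] at h1
    exact h h1
  have hc : ContinuousAt (fun w => 1 - Q ^ m * w) w₀ := by fun_prop
  filter_upwards [eventually_norm_eq continuousAt_id hw₀, eventually_norm_eq hc hne] with w h1 h2
  rw [hm w h1, hm w₀ rfl, h2]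

theorem eventually_norm_theta_of_eq_zero {Q w₀ : K} (hQ : ‖Q‖ < 1) (hQ0 : Q ≠ 0) (hw₀ : w₀ ≠ 0)
    (h : theta Q w₀ = 0) : ∃ C : ℝ, 0 < C ∧ ∀ᶠ w in 𝓝 w₀, ‖theta Q w‖ = C * ‖w - w₀‖ := by
  obtain ⟨C, hC, m, hm⟩ := norm_theta hQ hQ0 hw₀
  have h0 : 1 - Q ^ m * w₀ = 0 := by
    have h1 := hm w₀ rfl
    rwa [h, norm_zero, zero_eq_mul, or_iff_right hC.ne', norm_eq_zero] at h1
  have hQm : 0 < ‖Q ^ m‖ := norm_pos_iff.2 (zpow_ne_zero _ hQ0)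
  refine ⟨C * ‖Q ^ m‖, by positivity, ?_⟩
  filter_upwards [eventually_norm_eq continuousAt_id hw₀] with w h1
  rw [hm w h1, show 1 - Q ^ m * w = -(Q ^ m * (w - w₀)) by linear_combination h0, norm_neg,
    norm_mul, mul_assoc]

/-- The local behaviour of `u ↦ theta Q (u ^ n / b)`. -/
theorem eventually_norm_theta_pow {Q b u₀ : K} (hQ : ‖Q‖ < 1) (hQ0 : Q ≠ 0) (hb : b ≠ 0)
    (hu₀ : u₀ ≠ 0) {n : ℕ} (hn : (n : K) ≠ 0) (h : theta Q (u₀ ^ n / b) = 0) :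
    ∃ C : ℝ, 0 < C ∧ ∀ᶠ u in 𝓝 u₀, ‖theta Q (u ^ n / b)‖ = C * ‖u - u₀‖ := by
  obtain ⟨C, hC, h1⟩ :=
    eventually_norm_theta_of_eq_zero hQ hQ0 (div_ne_zero (pow_ne_zero n hu₀) hb) h
  obtain ⟨D, hD, h2⟩ := eventually_norm_pow_sub_pow hn hu₀
  have hc : ContinuousAt (fun u : K => u ^ n / b) u₀ := by fun_prop
  have hbn : 0 < ‖b‖ := norm_pos_iff.2 hb
  refine ⟨C * (D / ‖b‖), by positivity, ?_⟩
  filter_upwards [hc.eventually h1, h2] with u h3 h4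
  rw [h3, ← sub_div, norm_div, h4]
  ring

end

/-! ### Partial fractions of finite products -/

section

/-- The inductive step on one term: multiplying a simple pole at `1 / x` by a factor with its pole
at `1 / y` splits into simple poles at both points. -/
theorem mul_div_one_sub_eq {F : Type*} [Field F] {x y w : F} (b : F) (hx : x ≠ 0) (hy : y ≠ 0)
    (hxy : x ≠ y) (h1 : 1 - x * w ≠ 0) (h2 : 1 - y * w ≠ 0) :
    (1 - b * w) / (1 - y * w) * (x * w / (1 - x * w)) =
      (1 - b / y) * (y * w / (1 - y * w)) * (x * (1 / y) / (1 - x * (1 / y))) +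
        (1 - b / x) / (1 - y / x) * (x * w / (1 - x * w)) := by
  have h3 : y - x ≠ 0 := sub_ne_zero.2 hxy.symm
  have h4 : x * (1 / y) / (1 - x * (1 / y)) = x / (y - x) := by
    field_simp
  have h5 : (1 - b / x) / (1 - y / x) = (b - x) / (y - x) := by
    rw [one_sub_div hx, one_sub_div hx, div_div_div_cancel_right₀ hx, ← neg_sub y x,
      ← neg_sub b x, neg_div_neg_eq]
  have h6 : (1 - b / y) * (y * w / (1 - y * w)) = (y - b) * w / (1 - y * w) := by
    field_simp
  rw [h4, h5, h6, div_mul_div_comm, div_mul_div_comm, div_mul_div_comm,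
    div_add_div _ _ (mul_ne_zero h2 h3) (mul_ne_zero h3 h1),
    div_eq_div_iff (mul_ne_zero h2 h1) (mul_ne_zero (mul_ne_zero h2 h3) (mul_ne_zero h3 h1))]
  ring

/-- Partial fractions for a product of linear fractional functions with simple poles. -/
theorem prod_div_eq_one_add_sum {ι F : Type*} [DecidableEq ι] [Field F] (a b : ι → F)
    (s : Finset ι) (ha : ∀ i ∈ s, a i ≠ 0) (hinj : Set.InjOn a s) (w : F)
    (hw : ∀ i ∈ s, 1 - a i * w ≠ 0) :
    ∏ i ∈ s, (1 - b i * w) / (1 - a i * w) =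
      1 + ∑ j ∈ s, (∏ i ∈ s, (1 - b i / a j) / (if i = j then 1 else 1 - a i / a j)) *
        (a j * w / (1 - a j * w)) := by
  induction s using Finset.induction_on generalizing w with
  | empty => simp
  | insert k s hk ih =>
    have hak : a k ≠ 0 := ha k (Finset.mem_insert_self _ _)
    have hinj' : Set.InjOn a s := hinj.mono (by simp)
    have ha' : ∀ i ∈ s, a i ≠ 0 := fun i hi => ha i (Finset.mem_insert_of_mem hi)
    have hne : ∀ i ∈ s, a i ≠ a k := fun i hi h =>
      by
      have : i = k := hinj (by simp [hi]) (by simp) h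
      exact hk (this ▸ hi)
    have hwk : 1 - a k * w ≠ 0 := hw k (Finset.mem_insert_self _ _)
    have hw' : ∀ i ∈ s, 1 - a i * w ≠ 0 := fun i hi => hw i (Finset.mem_insert_of_mem hi)
    -- The induction hypothesis is used twice: at `w`, and at the new pole `1 / a k`, where the
    -- value of the old product is the coefficient of that pole.
    have ihw := ih ha' hinj' w hw'
    have hk1 : ∀ i ∈ s, 1 - a i * (1 / a k) ≠ 0 := fun i hi h => hne i hi (by
      field_simp at h
      linear_combination -h)
    have ihk := ih ha' hinj' (1 / a k) hk1
    rw [Finset.prod_insert hk, Finset.sum_insert hk, Finset.prod_insert hk, if_pos rfl, ihw]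
    have e1 : ∏ i ∈ s, (1 - b i / a k) / (if i = k then 1 else 1 - a i / a k) =
        ∏ i ∈ s, (1 - b i * (1 / a k)) / (1 - a i * (1 / a k)) := by
      refine Finset.prod_congr rfl fun i hi => ?_
      rw [if_neg (show ¬i = k from fun h => hk (h ▸ hi)), mul_one_div, mul_one_div]
    rw [e1, ihk]
    have hG : (1 - b k * w) / (1 - a k * w) =
        1 + (1 - b k / a k) * (a k * w / (1 - a k * w)) := by
      rw [div_eq_iff hwk, add_mul, mul_assoc, div_mul_cancel₀ _ hwk]
      field_simp
      ring
    have hsum : (1 - b k * w) / (1 - a k * w) * ∑ j ∈ s,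
          (∏ i ∈ s, (1 - b i / a j) / (if i = j then 1 else 1 - a i / a j)) *
            (a j * w / (1 - a j * w)) =
        (1 - b k / a k) * (a k * w / (1 - a k * w)) * (∑ j ∈ s,
          (∏ i ∈ s, (1 - b i / a j) / (if i = j then 1 else 1 - a i / a j)) *
            (a j * (1 / a k) / (1 - a j * (1 / a k)))) +
        ∑ j ∈ s, (∏ i ∈ insert k s, (1 - b i / a j) / (if i = j then 1 else 1 - a i / a j)) *
            (a j * w / (1 - a j * w)) := by
      rw [Finset.mul_sum, Finset.mul_sum, ← Finset.sum_add_distrib]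
      refine Finset.sum_congr rfl fun j hj => ?_
      rw [Finset.prod_insert hk, if_neg (show ¬k = j from fun h => hk (h ▸ hj))]
      generalize ∏ i ∈ s, (1 - b i / a j) / (if i = j then 1 else 1 - a i / a j) = P
      have h := mul_div_one_sub_eq (b k) (ha' j hj) hak (hne j hj) (hw' j hj) hwk
      linear_combination P * h
    rw [mul_add, mul_one, hsum, hG]
    ring

end

/-! ### The truncated Kronecker identity -/

section

theorem prod_Ioc_int {M : Type*} [CommMonoid M] (G : ℤ → M) (a b : ℕ) :
    ∏ i ∈ Finset.Ioc (-(a : ℤ)) b, G i =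
      (∏ i ∈ Finset.range b, G (i + 1)) * ∏ i ∈ Finset.range a, G (-i) := by
  induction b with
  | zero =>
    rw [Finset.prod_range_zero, one_mul]
    symm
    refine Finset.prod_bij (fun i _ => -(i : ℤ)) ?_ ?_ ?_ ?_
    · intro i hi
      have := Finset.mem_range.1 hi
      simp only [Finset.mem_Ioc, Nat.cast_zero]
      omega
    · intro i _ j _ h
      omega
    · intro i hi
      have := Finset.mem_Ioc.1 hi
      exact ⟨(-i).toNat, by simp only [Finset.mem_range]; omega, by omega⟩
    · intro i _
      rfl
  | succ b ih =>
    have h : Finset.Ioc (-(a : ℤ)) ((b + 1 : ℕ) : ℤ) =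
        insert ((b : ℤ) + 1) (Finset.Ioc (-(a : ℤ)) b) := by
      ext i
      simp only [Finset.mem_Ioc, Finset.mem_insert]
      omega
    rw [h, Finset.prod_insert (by simp), ih, Finset.prod_range_succ, ← mul_assoc,
      mul_comm (G _)]

variable {K : Type u} [NontriviallyNormedField K]

/-- The partial products of `∏_{j ≥ 1} (1 - Q ^ j * x) / (1 - Q ^ j)`. -/
noncomputable def partialRatio (Q x : K) (m : ℕ) : K :=
  ∏ i ∈ Finset.range m, (1 - Q ^ (i + 1) * x) / (1 - Q ^ (i + 1))

/-- The coefficient of `geom (Q ^ j * w)` in the partial fraction expansion of the truncated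
quotient `theta Q (w / b) / theta Q w`. -/
noncomputable def kroneckerCoeff (Q b : K) (N : ℕ) (j : ℤ) : K :=
  if j ∈ Finset.Ioc (-(N : ℤ)) N then
    (b - 1) * b ^ (-j) * partialRatio Q b⁻¹ (N - j).toNat * partialRatio Q b (N + j - 1).toNat
  else 0

/-- Substituting `d = i - j` leaves `N - j` positive indices, `d = 0`, and `N + j - 1` negative
ones. Rewriting the negative factors in positive powers of `Q` releases powers of `b⁻¹`, which
combine with `b ^ N` to `b ^ (-j)`. -/
theorem prod_ratio_eq {Q b : K} (hQ0 : Q ≠ 0) (hQ1 : ∀ i : ℤ, i ≠ 0 → Q ^ i ≠ 1) (hb : b ≠ 0)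
    (N : ℕ) {j : ℤ} (hj : j ∈ Finset.Ioc (-(N : ℤ)) N) :
    b ^ N * ∏ i ∈ Finset.Ioc (-(N : ℤ)) N,
      (1 - Q ^ i / b / Q ^ j) / (if i = j then 1 else 1 - Q ^ i / Q ^ j) =
      kroneckerCoeff Q b N j := by
  rw [kroneckerCoeff, if_pos hj]
  rw [Finset.mem_Ioc] at hj
  obtain ⟨A, hA⟩ : ∃ A : ℕ, (A : ℤ) = N + j - 1 := ⟨(N + j - 1).toNat, by omega⟩
  obtain ⟨B, hB⟩ : ∃ B : ℕ, (B : ℤ) = N - j := ⟨(N - j).toNat, by omega⟩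
  rw [show (N - j).toNat = B by omega, show (N + j - 1).toNat = A by omega]
  set F : ℤ → K := fun d => (1 - Q ^ d / b) / (if d = 0 then 1 else 1 - Q ^ d) with hF
  have e1 : ∏ i ∈ Finset.Ioc (-(N : ℤ)) N,
      (1 - Q ^ i / b / Q ^ j) / (if i = j then 1 else 1 - Q ^ i / Q ^ j) =
      ∏ d ∈ Finset.Ioc (-((A + 1 : ℕ) : ℤ)) B, F d := by
    refine Finset.prod_bij (fun i _ => i - j) ?_ ?_ ?_ ?_
    · intro i hi
      rw [Finset.mem_Ioc] at hi ⊢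
      push_cast
      omega
    · intro i _ i' _ h
      omega
    · intro d hd
      rw [Finset.mem_Ioc] at hd
      push_cast at hd
      exact ⟨d + j, by rw [Finset.mem_Ioc]; omega, by omega⟩
    · intro i _
      simp only [hF, sub_eq_zero]
      rw [div_right_comm, ← zpow_sub₀ hQ0]
  have e2 : ∏ i ∈ Finset.range B, F (i + 1) = partialRatio Q b⁻¹ B := by
    refine Finset.prod_congr rfl fun i _ => ?_
    have : (i : ℤ) + 1 ≠ 0 := by omega
    simp only [hF, if_neg this, div_eq_mul_inv]
    norm_cast
  have e3 : ∏ i ∈ Finset.range A, F (-((i + 1 : ℕ) : ℤ)) = b⁻¹ ^ A * partialRatio Q b A := by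
    rw [partialRatio, ← Finset.card_range A, ← Finset.prod_const, Finset.card_range,
      ← Finset.prod_mul_distrib]
    refine Finset.prod_congr rfl fun i _ => ?_
    have h0 : -((i + 1 : ℕ) : ℤ) ≠ 0 := by omega
    have h1 : 1 - Q ^ (i + 1) ≠ 0 := by
      have := hQ1 ((i + 1 : ℕ) : ℤ) (by omega)
      rw [zpow_natCast] at this
      exact sub_ne_zero.2 this.symm
    have h2 : Q ^ (i + 1) - 1 ≠ 0 := by
      rw [← neg_sub]
      exact neg_ne_zero.2 h1
    have h3 : Q ^ (i + 1) ≠ 0 := pow_ne_zero _ hQ0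
    simp only [hF, if_neg h0]
    rw [zpow_neg, zpow_natCast]
    generalize Q ^ (i + 1) = z at *
    rw [show (1 - z⁻¹ / b) / (1 - z⁻¹) = (b * z - 1) / (b * (z - 1)) by field_simp,
      ← neg_sub 1 (b * z), ← neg_sub 1 z, mul_neg, neg_div_neg_eq]
    field_simp
  rw [e1, prod_Ioc_int, e2, Finset.prod_range_succ', e3]
  have e4 : F (-((0 : ℕ) : ℤ)) = b⁻¹ * (b - 1) := by
    simp [hF]
    field_simp
  rw [e4]
  have e5 : b ^ N * b⁻¹ ^ A * b⁻¹ = b ^ (-j) := by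
    rw [← zpow_natCast, ← zpow_natCast, inv_zpow', ← zpow_neg_one, ← zpow_add₀ hb, ← zpow_add₀ hb]
    congr 1
    omega
  rw [← e5]
  ring

/-- Partial fractions for the finite product over `-N < i ≤ N`. The factor `b ^ N` comes from
rewriting the `N` factors in `w⁻¹` as factors in `w`; it is also the value at `w = 0`, hence the
constant term. -/
theorem truncated_kronecker {Q b w : K} (hQ0 : Q ≠ 0) (hQ1 : ∀ i : ℤ, i ≠ 0 → Q ^ i ≠ 1)
    (hb : b ≠ 0) (hw : w ≠ 0) (hw1 : ∀ m : ℤ, Q ^ m * w ≠ 1) (N : ℕ) :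
    ((∏ i ∈ Finset.range N, (1 - Q ^ (i + 1) * (w / b))) *
        ∏ i ∈ Finset.range N, (1 - Q ^ i * (w / b)⁻¹)) /
      ((∏ i ∈ Finset.range N, (1 - Q ^ (i + 1) * w)) *
        ∏ i ∈ Finset.range N, (1 - Q ^ i * w⁻¹)) =
      b ^ N + ∑ j ∈ Finset.Ioc (-(N : ℤ)) N, kroneckerCoeff Q b N j * geom (Q ^ j * w) := by
  have hpf := prod_div_eq_one_add_sum (fun i : ℤ => Q ^ i) (fun i : ℤ => Q ^ i / b)
    (Finset.Ioc (-(N : ℤ)) N) (fun i _ => zpow_ne_zero i hQ0) (fun i _ j _ h => by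
      by_contra hij
      refine hQ1 (i - j) (sub_ne_zero.2 hij) ?_
      have h' : Q ^ i = Q ^ j := h
      rw [zpow_sub₀ hQ0, h', div_self (zpow_ne_zero _ hQ0)]) w
    (fun i _ => sub_ne_zero.2 (hw1 i).symm)
  have hsum : b ^ N * ∏ i ∈ Finset.Ioc (-(N : ℤ)) N, (1 - Q ^ i / b * w) / (1 - Q ^ i * w) =
      b ^ N + ∑ j ∈ Finset.Ioc (-(N : ℤ)) N, kroneckerCoeff Q b N j * geom (Q ^ j * w) := by
    rw [hpf, mul_add, mul_one, Finset.mul_sum]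
    congr 1
    refine Finset.sum_congr rfl fun j hj => ?_
    rw [← prod_ratio_eq hQ0 hQ1 hb N hj, geom, mul_assoc]
  rw [← hsum, prod_Ioc_int, Finset.prod_div_distrib, mul_div_mul_comm, ← Finset.prod_div_distrib,
    ← Finset.prod_div_distrib, ← Finset.prod_div_distrib, mul_left_comm]
  congr 1
  · refine Finset.prod_congr rfl fun i _ => ?_
    norm_cast
    rw [mul_div_assoc', div_mul_eq_mul_div]
  · rw [← Finset.card_range N, ← Finset.prod_const, Finset.card_range, ← Finset.prod_mul_distrib]
    refine Finset.prod_congr rfl fun i _ => ?_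
    have h1 : Q ^ i - w ≠ 0 := by
      intro h
      refine hw1 (-i) ?_
      rw [zpow_neg, zpow_natCast, inv_mul_eq_one₀ (pow_ne_zero _ hQ0), sub_eq_zero.1 h]
    have h2 : w - Q ^ i ≠ 0 := by rwa [← neg_sub, neg_ne_zero]
    rw [zpow_neg, zpow_natCast]
    have h3 : Q ^ i ≠ 0 := pow_ne_zero _ hQ0
    generalize Q ^ i = z at *
    rw [show 1 - z * w⁻¹ = (w - z) / w by field_simp, show 1 - z⁻¹ * w = -(w - z) / z by
      field_simp; ring]
    field_simp
    ring

end

/-! ### Kronecker's identity in the limit -/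

section

variable {K : Type u} [NontriviallyNormedField K] [IsUltrametricDist K]

theorem norm_partialRatio {Q x : K} (hQ : ‖Q‖ < 1) (hx : ‖Q * x‖ < 1) (m : ℕ) :
    ‖partialRatio Q x m‖ = 1 := by
  rw [partialRatio, norm_prod]
  refine Finset.prod_eq_one fun i _ => ?_
  have hi : ‖Q‖ ^ i ≤ 1 := pow_le_one₀ (norm_nonneg _) hQ.le
  rw [norm_div, norm_one_sub_eq_one, norm_one_sub_eq_one, div_one]
  · rw [norm_pow]
    exact pow_lt_one₀ (norm_nonneg _) hQ (Nat.succ_ne_zero i)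
  · rw [pow_succ, mul_assoc, norm_mul, norm_pow]
    exact (mul_le_of_le_one_left (norm_nonneg _) hi).trans_lt hx

/-- Since `‖Q‖ < ‖b‖ < 1`, both partial ratios have norm `1`. The bound does not depend on `N`, as
dominated convergence requires. -/
theorem norm_kroneckerCoeff_le {Q b : K} (hQ : ‖Q‖ < 1) (hQb : ‖Q‖ < ‖b‖) (hb1 : ‖b‖ < 1)
    (N : ℕ) (j : ℤ) : ‖kroneckerCoeff Q b N j‖ ≤ ‖b ^ (-j)‖ := by
  have hbn : 0 < ‖b‖ := (norm_nonneg _).trans_lt hQb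
  rw [kroneckerCoeff]
  split_ifs
  · rw [norm_mul, norm_mul, norm_mul, norm_partialRatio hQ, norm_partialRatio hQ, ← norm_neg,
      neg_sub, norm_one_sub_eq_one hb1, one_mul, mul_one, mul_one]
    · rw [norm_mul]
      exact (mul_le_of_le_one_right (norm_nonneg _) hb1.le).trans_lt hQ
    · rwa [norm_mul, norm_inv, ← div_eq_mul_inv, div_lt_one hbn]
  · rw [norm_zero]
    exact norm_nonneg _

/-- The terms behave like `(‖Q‖ / ‖b‖) ^ j` as `j → ∞` and like `‖b‖ ^ (-j)` as `j → -∞`, so the two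
inequalities on `‖b‖` give the two tails. -/
theorem summable_norm_kronecker {Q b w : K} (hQ : ‖Q‖ < 1) (hQ0 : Q ≠ 0) (hQb : ‖Q‖ < ‖b‖)
    (hb1 : ‖b‖ < 1) (hw : w ≠ 0) :
    Summable fun j : ℤ => ‖b ^ (-j)‖ * ‖geom (Q ^ j * w)‖ := by
  have hbn : 0 < ‖b‖ := (norm_nonneg _).trans_lt hQb
  have hQn : 0 < ‖Q‖ := norm_pos_iff.2 hQ0
  have hpow : ∀ x : K, ∀ᶠ j : ℕ in atTop, ‖Q ^ j * x‖ < 1 := by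
    intro x
    have := ((tendsto_pow_atTop_nhds_zero_of_norm_lt_one hQ).mul_const x).norm
    rw [zero_mul, norm_zero] at this
    exact this.eventually_lt_const one_pos
  refine Summable.of_nat_of_neg ?_ ?_
  · have hs : Summable fun j : ℕ => (‖Q‖ / ‖b‖) ^ j * ‖w‖ :=
      (summable_geometric_of_lt_one (by positivity) ((div_lt_one hbn).2 hQb)).mul_right _
    refine summable_of_isBigO_nat hs (EventuallyEq.isBigO ?_)
    filter_upwards [hpow w] with j hj
    rw [zpow_natCast, geom, norm_div, norm_one_sub_eq_one hj, norm_zpow, norm_mul, norm_pow,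
      zpow_neg, zpow_natCast, div_pow]
    field_simp
  · have hs : Summable fun j : ℕ => ‖b‖ ^ j := summable_geometric_of_lt_one hbn.le hb1
    refine summable_of_isBigO_nat hs (EventuallyEq.isBigO ?_)
    filter_upwards [hpow w⁻¹] with j hj
    have hz : Q ^ j ≠ 0 := pow_ne_zero _ hQ0
    have e : geom (Q ^ (-(j : ℤ)) * w) = -(1 - Q ^ j * w⁻¹)⁻¹ := by
      have h1 : 1 - Q ^ j * w⁻¹ ≠ 0 := by
        rw [← norm_ne_zero_iff, norm_one_sub_eq_one hj]
        exact one_ne_zero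
      rw [zpow_neg, zpow_natCast, geom]
      generalize Q ^ j = z at *
      have h2 : w - z ≠ 0 := by
        intro h
        apply h1
        rw [← sub_eq_zero.1 h, mul_inv_cancel₀ hw, sub_self]
      rw [show 1 - z * w⁻¹ = (w - z) / w by field_simp, show 1 - z⁻¹ * w = -(w - z) / z by
        field_simp; ring]
      field_simp
    rw [e, norm_neg, norm_inv, norm_one_sub_eq_one hj, neg_neg, zpow_natCast, norm_pow]
    simp

variable [CompleteSpace K]

theorem tprod_one_sub_succ_ne_zero {Q : K} (hQ : ‖Q‖ < 1) :
    ∏' i : ℕ, (1 - Q ^ (i + 1)) ≠ 0 := by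
  have h : ∏' i : ℕ, (1 - Q ^ (i + 1)) = ∏' i : ℕ, (1 - Q ^ i * Q) :=
    tprod_congr fun i => by rw [pow_succ]
  rw [h, ← norm_ne_zero_iff, norm_tprod_one_sub hQ hQ]
  exact one_ne_zero

theorem tendsto_partialRatio {Q : K} (hQ : ‖Q‖ < 1) (x : K) :
    Tendsto (partialRatio Q x) atTop
      (𝓝 ((∏' i : ℕ, (1 - Q ^ (i + 1) * x)) / ∏' i : ℕ, (1 - Q ^ (i + 1)))) := by
  have h1 := (multipliable_one_sub_succ hQ x).hasProd.tendsto_prod_nat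
  have h2 := (multipliable_one_sub_succ hQ 1).hasProd.tendsto_prod_nat
  simp only [mul_one] at h2
  refine (h1.div h2 (tprod_one_sub_succ_ne_zero hQ)).congr fun m => ?_
  rw [partialRatio, Finset.prod_div_distrib]
  rfl

/-- The constant in Kronecker's identity `theta_div_theta`. -/
noncomputable def kroneckerConst (Q b : K) : K :=
  -theta Q b⁻¹ / (∏' i : ℕ, (1 - Q ^ (i + 1))) ^ 2

/-- A zero would make `b` a power of `Q`, but `‖b‖` lies strictly between `‖Q‖` and `1`. -/
theorem kroneckerConst_ne_zero {Q b : K} (hQ : ‖Q‖ < 1) (hQb : ‖Q‖ < ‖b‖) (hb1 : ‖b‖ < 1)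
    (hQ0 : Q ≠ 0) : kroneckerConst Q b ≠ 0 := by
  have hb0 : b ≠ 0 := norm_pos_iff.1 ((norm_nonneg _).trans_lt hQb)
  have hbn : 0 < ‖b‖ := norm_pos_iff.2 hb0
  have hQn : 0 < ‖Q‖ := norm_pos_iff.2 hQ0
  refine div_ne_zero (neg_ne_zero.2 fun h => ?_) (pow_ne_zero _ (tprod_one_sub_succ_ne_zero hQ))
  obtain ⟨m, hm⟩ := (theta_eq_zero_iff hQ hQ0 (inv_ne_zero hb0)).1 h
  have hm' : ‖b‖ = ‖Q‖ ^ (-m) := by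
    rw [← norm_zpow, zpow_neg, ← hm, inv_inv]
  rcases lt_trichotomy 0 (-m) with h | h | h
  · have : ‖Q‖ ^ (-m) ≤ ‖Q‖ ^ (1 : ℤ) := zpow_le_zpow_right_of_le_one₀ hQn hQ.le (by omega)
    rw [zpow_one] at this
    linarith
  · rw [← h, zpow_zero] at hm'
    linarith
  · have := one_lt_zpow_of_neg₀ hQn hQ h
    linarith

theorem tendsto_kroneckerCoeff {Q b : K} (hQ : ‖Q‖ < 1) (j : ℤ) :
    Tendsto (fun N => kroneckerCoeff Q b N j) atTop (𝓝 (kroneckerConst Q b * b ^ (-j))) := by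
  have t1 : Tendsto (fun N : ℕ => ((N : ℤ) - j).toNat) atTop atTop :=
    tendsto_atTop.2 fun c => by
      filter_upwards [eventually_ge_atTop (c + j.toNat)] with N hN
      change c ≤ _
      omega
  have t2 : Tendsto (fun N : ℕ => ((N : ℤ) + j - 1).toNat) atTop atTop :=
    tendsto_atTop.2 fun c => by
      filter_upwards [eventually_ge_atTop (c + (-j).toNat + 1)] with N hN
      omega
  have t3 := (tendsto_partialRatio hQ b⁻¹).comp t1
  have t4 := (tendsto_partialRatio hQ b).comp t2
  have t := (t3.const_mul ((b - 1) * b ^ (-j))).mul t4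
  have e : ∏' i : ℕ, (1 - Q ^ i * b) = (1 - b) * ∏' i : ℕ, (1 - Q ^ (i + 1) * b) := by
    rw [tprod_eq_zero_mul' (f := fun i => 1 - Q ^ i * b) (multipliable_one_sub_succ hQ b),
      pow_zero, one_mul]
  have hc : (b - 1) * b ^ (-j) *
      ((∏' i : ℕ, (1 - Q ^ (i + 1) * b⁻¹)) / ∏' i : ℕ, (1 - Q ^ (i + 1))) *
      ((∏' i : ℕ, (1 - Q ^ (i + 1) * b)) / ∏' i : ℕ, (1 - Q ^ (i + 1))) =
      kroneckerConst Q b * b ^ (-j) := by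
    rw [kroneckerConst, theta, inv_inv, e]
    generalize ∏' i : ℕ, (1 - Q ^ (i + 1) * b⁻¹) = x
    generalize ∏' i : ℕ, (1 - Q ^ (i + 1) * b) = y
    generalize ∏' i : ℕ, (1 - Q ^ (i + 1)) = z
    ring
  rw [hc] at t
  refine t.congr' ?_
  filter_upwards [eventually_ge_atTop (j.natAbs + 1)] with N hN
  have hj : j ∈ Finset.Ioc (-(N : ℤ)) N := Finset.mem_Ioc.2 (by omega)
  simp only [kroneckerCoeff, if_pos hj, Function.comp]

/-- Kronecker's identity. -/
theorem theta_div_theta {Q b w : K} (hQ : ‖Q‖ < 1) (hQ0 : Q ≠ 0) (hQb : ‖Q‖ < ‖b‖)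
    (hb1 : ‖b‖ < 1) (hw : w ≠ 0) (hw1 : ∀ m : ℤ, Q ^ m * w ≠ 1) :
    theta Q (w / b) / theta Q w =
      kroneckerConst Q b * ∑' j : ℤ, b ^ (-j) * geom (Q ^ j * w) := by
  have hb0 : b ≠ 0 := norm_pos_iff.1 ((norm_nonneg _).trans_lt hQb)
  have hth : theta Q w ≠ 0 := by
    intro h
    obtain ⟨m, hm⟩ := (theta_eq_zero_iff hQ hQ0 hw).1 h
    refine hw1 (-m) ?_
    rw [hm, ← zpow_add₀ hQ0, neg_add_cancel, zpow_zero]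
  have t1 := (((multipliable_one_sub_succ hQ (w / b)).hasProd.tendsto_prod_nat.mul
    (multipliable_one_sub hQ (w / b)⁻¹).hasProd.tendsto_prod_nat)).div
    ((multipliable_one_sub_succ hQ w).hasProd.tendsto_prod_nat.mul
    (multipliable_one_sub hQ w⁻¹).hasProd.tendsto_prod_nat) hth
  have t2 : Tendsto (fun N : ℕ => ∑' j : ℤ, kroneckerCoeff Q b N j * geom (Q ^ j * w)) atTop
      (𝓝 (∑' j : ℤ, kroneckerConst Q b * b ^ (-j) * geom (Q ^ j * w))) := by
    refine tendsto_tsum_of_dominated_convergence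
      (summable_norm_kronecker hQ hQ0 hQb hb1 hw)
      (fun j => (tendsto_kroneckerCoeff hQ j).mul_const _) (Eventually.of_forall fun N j => ?_)
    rw [norm_mul]
    exact mul_le_mul_of_nonneg_right (norm_kroneckerCoeff_le hQ hQb hb1 N j) (norm_nonneg _)
  -- The constant term `b ^ N` disappears because `‖b‖ < 1`.
  have t3 := (tendsto_pow_atTop_nhds_zero_of_norm_lt_one hb1).add t2
  simp only [mul_assoc] at t3
  rw [zero_add, tsum_mul_left] at t3
  refine tendsto_nhds_unique t1 (t3.congr fun N => ?_)
  refine Eq.trans ?_ (truncated_kronecker hQ0 (fun i hi => zpow_ne_one hQ hQ0 hi) hb0 hw hw1 N).symm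
  rw [tsum_eq_sum (s := Finset.Ioc (-(N : ℤ)) N)]
  intro j hj
  rw [kroneckerCoeff, if_neg hj, zero_mul]

end

/-! ### The theta quotient as a sum of Lambert zeta functions -/

section

/-- Orthogonality of roots of unity: of the exponents `k + 2` with `0 ≤ k < n`, only `k = n - 2` is
divisible by `n`. -/
theorem sum_pow_mul_geom {K : Type u} [NontriviallyNormedField K] {n : ℕ} (hn : 2 ≤ n) {ζ : K}
    (hζ : IsPrimitiveRoot ζ n) {t : K} (ht : t ^ n ≠ 1) :
    ∑ i ∈ Finset.range n, ζ ^ i * geom (ζ ^ i * t) = n * (t ^ (n - 1) / (1 - t ^ n)) := by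
  have h1 : 1 - t ^ n ≠ 0 := sub_ne_zero.2 ht.symm
  have hroot : ∀ i, (ζ ^ i * t) ^ n = t ^ n := fun i => by
    rw [mul_pow, ← pow_mul, mul_comm i, pow_mul, hζ.pow_eq_one, one_pow, one_mul]
  have hterm : ∀ i, ζ ^ i * geom (ζ ^ i * t) =
      ∑ k ∈ Finset.range n, (ζ ^ (k + 2)) ^ i * (t ^ (k + 1) / (1 - t ^ n)) := by
    intro i
    have h2 : 1 - ζ ^ i * t ≠ 0 := fun h => ht (by
      rw [← hroot i, ← sub_eq_zero.1 h, one_pow])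
    have h3 := mul_neg_geom_sum (ζ ^ i * t) n
    rw [hroot] at h3
    have h4 : geom (ζ ^ i * t) =
        ζ ^ i * t * (∑ k ∈ Finset.range n, (ζ ^ i * t) ^ k) / (1 - t ^ n) := by
      rw [geom, div_eq_div_iff h2 h1, ← h3]
      ring
    rw [h4, ← mul_div_assoc, ← mul_assoc, Finset.mul_sum, Finset.sum_div]
    refine Finset.sum_congr rfl fun k _ => ?_
    ring
  simp only [hterm]
  rw [Finset.sum_comm, Finset.sum_eq_single (n - 2)]
  · rw [show n - 2 + 2 = n by omega, show n - 2 + 1 = n - 1 by omega, hζ.pow_eq_one]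
    simp
  · intro k hk hkn
    rw [← Finset.sum_mul]
    have hk' := Finset.mem_range.1 hk
    have h2 : ζ ^ (k + 2) ≠ 1 := by
      rw [Ne, hζ.pow_eq_one_iff_dvd]
      rintro ⟨d, hd⟩
      rcases d with _ | _ | d
      · omega
      · omega
      · nlinarith
    have h3 := geom_sum_mul (ζ ^ (k + 2)) n
    rw [← pow_mul, mul_comm _ n, pow_mul, hζ.pow_eq_one, one_pow, sub_self] at h3
    rw [(mul_eq_zero.1 h3).resolve_right (sub_ne_zero.2 h2), zero_mul]
  · intro h
    exact absurd (Finset.mem_range.2 (by omega)) h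

variable {K : Type u} [NontriviallyNormedField K]

theorem norm_pow_lt_norm {q : K} (hq : ‖q‖ < 1) (hq0 : q ≠ 0) {n : ℕ} (hn : 2 ≤ n) :
    ‖q ^ n‖ < ‖q‖ := by
  rw [norm_pow]
  exact pow_lt_self_of_lt_one₀ (norm_pos_iff.2 hq0) hq (by omega)

theorem analyticAt_tsum_mul_pow [CompleteSpace K] {c : ℕ → K} (hc : ∀ j, ‖c j‖ ≤ 1) {t : K}
    (ht : ‖t‖ < 1) :
    AnalyticAt K (fun x => ∑' j : ℕ, c j * x ^ j) t := by
  set p := FormalMultilinearSeries.ofScalars K c with hp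
  have hr : 1 ≤ p.radius := by
    have := p.le_radius_of_bound 1 (r := 1) fun n => by
      rw [NNReal.coe_one, one_pow, mul_one, hp, FormalMultilinearSeries.ofScalars_norm]
      exact hc n
    exact_mod_cast this
  have h := p.hasFPowerSeriesOnBall (zero_lt_one.trans_le hr)
  have hmem : t ∈ Metric.eball (0 : K) p.radius := by
    refine Metric.eball_subset_eball hr ?_
    rw [Metric.mem_eball, edist_zero_right, ← ofReal_norm]
    exact ENNReal.ofReal_lt_one.2 ht
  refine (h.analyticAt_of_mem hmem).congr (Eventually.of_forall fun x => ?_)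
  have := FormalMultilinearSeries.ofScalars_sum_eq c x
  simpa [FormalMultilinearSeries.ofScalarsSum] using this

variable [IsUltrametricDist K] [CompleteSpace K]

/-- The partial fraction expansion of the theta quotient. -/
theorem thetaQuotient_eq_sum {q : K} (hq : ‖q‖ < 1) (hq0 : q ≠ 0) {n : ℕ} (hn : 2 ≤ n)
    (hnK : (n : K) ≠ 0) {ζ : K} (hζ : IsPrimitiveRoot ζ n) {u : K} (hu : u ≠ 0)
    (hu1 : ∀ m : ℤ, (q ^ m * u) ^ n ≠ 1) :
    thetaQuotient q n u = kroneckerConst (q ^ n) q / n *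
      ∑ i ∈ Finset.range n, ζ ^ i * lambertZeta q (ζ ^ i * u) := by
  have hn0 : n ≠ 0 := by omega
  have hζ0 : ζ ≠ 0 := hζ.ne_zero hn0
  have hQ : ‖q ^ n‖ < 1 := by
    rw [norm_pow]
    exact pow_lt_one₀ (norm_nonneg _) hq hn0
  have hw : ∀ m : ℤ, (q ^ n) ^ m * u ^ n = (q ^ m * u) ^ n := fun m => by
    rw [mul_pow, ← zpow_natCast q n, ← zpow_natCast (q ^ m) n, ← zpow_mul, ← zpow_mul,
      mul_comm m]
  have hk := theta_div_theta hQ (pow_ne_zero n hq0) (norm_pow_lt_norm hq hq0 hn) hq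
    (pow_ne_zero n hu) (fun m => by rw [hw]; exact hu1 m)
  have hroot : ∀ i, (ζ ^ i) ^ n = 1 := fun i => by
    rw [← pow_mul, mul_comm, pow_mul, hζ.pow_eq_one, one_pow]
  have hs : HasSum (fun j : ℤ => ∑ i ∈ Finset.range n, ζ ^ i * lambertTerm q (ζ ^ i * u) j)
      (∑ i ∈ Finset.range n, ζ ^ i * lambertZeta q (ζ ^ i * u)) :=
    hasSum_sum fun i _ => (summable_lambertTerm hq hq0
      (mul_ne_zero (pow_ne_zero i hζ0) hu)).hasSum.mul_left _
  have hterm : ∀ j : ℤ, ∑ i ∈ Finset.range n, ζ ^ i * lambertTerm q (ζ ^ i * u) j =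
      n * u⁻¹ * (q ^ (-j) * geom ((q ^ n) ^ j * u ^ n)) := by
    intro j
    have e : ∀ i, ζ ^ i * lambertTerm q (ζ ^ i * u) j =
        ζ ^ i * geom (ζ ^ i * (q ^ j * u)) + ζ ^ i * (if j < 0 then 1 else 0) := by
      intro i
      have h1 : q ^ j * (ζ ^ i * u) ≠ 1 := fun h => hu1 j (by
        have h2 : (q ^ j * (ζ ^ i * u)) ^ n = 1 := by rw [h, one_pow]
        rwa [mul_left_comm, mul_pow, hroot, one_mul] at h2)
      rw [mul_left_comm (ζ ^ i) (q ^ j), geom_eq_lambertTerm h1]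
      ring
    -- The regularizing constants in the terms with `j < 0` cancel because the roots of unity sum to
    -- `0`.
    have hgs : ∑ i ∈ Finset.range n, ζ ^ i = 0 := hζ.geom_sum_eq_zero (by omega)
    rw [Finset.sum_congr rfl fun i _ => e i, Finset.sum_add_distrib, ← Finset.sum_mul, hgs,
      zero_mul, add_zero, sum_pow_mul_geom hn hζ (hu1 j), hw, geom, zpow_neg]
    have hz : q ^ j ≠ 0 := zpow_ne_zero j hq0
    have hp : (q ^ j * u) ^ n = (q ^ j * u) ^ (n - 1) * (q ^ j * u) := by
      rw [← pow_succ, Nat.sub_add_cancel (by omega)]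
    nth_rewrite 2 [hp]
    generalize (q ^ j * u) ^ (n - 1) = x
    generalize 1 - (q ^ j * u) ^ n = y
    field_simp
  have htot := hs.tsum_eq
  simp only [hterm] at htot
  rw [tsum_mul_left] at htot
  rw [thetaQuotient_eq hq0 hn, mul_comm u, ← div_div, hk, ← htot]
  generalize ∑' j : ℤ, q ^ (-j) * geom ((q ^ n) ^ j * u ^ n) = S
  field_simp

/-! ### Meromorphy of the Lambert zeta function -/

/-- The one-sided sum `∑ m ≥ 0, geom (q ^ m * t)`. -/
noncomputable def lambertSeries (q t : K) : K := ∑' m : ℕ, geom (q ^ m * t)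

theorem summable_geom_nat {q : K} (hq : ‖q‖ < 1) (t : K) :
    Summable fun m : ℕ => geom (q ^ m * t) := by
  rw [NonarchimedeanAddGroup.summable_iff_tendsto_cofinite_zero, Nat.cofinite_eq_atTop]
  have h := (tendsto_pow_atTop_nhds_zero_of_norm_lt_one hq).mul_const t
  rw [zero_mul] at h
  have := continuousAt_geom_zero.tendsto.comp h
  rwa [show geom (0 : K) = 0 by simp [geom]] at this

theorem lambertSeries_eq_add {q : K} (hq : ‖q‖ < 1) (t : K) (M : ℕ) :
    lambertSeries q t = ∑ m ∈ Finset.range M, geom (q ^ m * t) + lambertSeries q (q ^ M * t) := by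
  rw [lambertSeries, ← (summable_geom_nat hq t).sum_add_tsum_nat_add M]
  congr 1
  exact tsum_congr fun m => by rw [pow_add, mul_assoc]

/-- Each term is expanded as a geometric series and the two summations are exchanged. The result is
a power series with bounded coefficients, hence analytic in the open unit disc. -/
theorem lambertSeries_eq_tsum {q t : K} (hq : ‖q‖ < 1) (ht : ‖t‖ < 1) :
    lambertSeries q t = t * ∑' j : ℕ, 1 / (1 - q ^ (j + 1)) * t ^ j := by
  have hpow : ∀ m : ℕ, ‖q ^ m * t‖ < 1 := fun m => by
    rw [norm_mul, norm_pow]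
    exact (mul_le_of_le_one_left (norm_nonneg _) (pow_le_one₀ (norm_nonneg _) hq.le)).trans_lt ht
  have h1 : ∀ m : ℕ, HasSum (fun j : ℕ => (q ^ m * t) ^ (j + 1)) (geom (q ^ m * t)) := fun m => by
    have := (hasSum_geometric_of_norm_lt_one (hpow m)).mul_left (q ^ m * t)
    rw [← div_eq_mul_inv] at this
    exact this.congr_fun fun j => pow_succ' _ _
  have h2 : ∀ j : ℕ, HasSum (fun m : ℕ => (q ^ m * t) ^ (j + 1))
      (t * (1 / (1 - q ^ (j + 1)) * t ^ j)) := fun j => by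
    have hj : ‖q ^ (j + 1)‖ < 1 := by
      rw [norm_pow]
      exact pow_lt_one₀ (norm_nonneg _) hq (Nat.succ_ne_zero j)
    have := (hasSum_geometric_of_norm_lt_one hj).mul_right (t ^ (j + 1))
    rw [show (1 - q ^ (j + 1))⁻¹ * t ^ (j + 1) = t * (1 / (1 - q ^ (j + 1)) * t ^ j) by
      rw [pow_succ]; ring] at this
    exact this.congr_fun fun m => by rw [mul_pow, ← pow_mul, ← pow_mul, mul_comm m]
  have hs : Summable (Function.uncurry fun (m j : ℕ) => (q ^ m * t) ^ (j + 1)) := by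
    have hb := (summable_geometric_of_lt_one (norm_nonneg _) hq).mul_of_nonneg
      ((summable_nat_add_iff 1).2 (summable_geometric_of_lt_one (norm_nonneg _) ht))
      (fun m => by positivity) (fun j => by positivity)
    refine Summable.of_norm_bounded hb ?_
    rintro ⟨m, j⟩
    rw [Function.uncurry_apply_pair, mul_pow, norm_mul, norm_pow, norm_pow, norm_pow]
    refine mul_le_mul_of_nonneg_right ?_ (by positivity)
    exact pow_le_of_le_one (by positivity) (pow_le_one₀ (norm_nonneg _) hq.le)
      (Nat.succ_ne_zero j)
  have h3 := hs.tsum_comm' (fun m => (h1 m).summable) (fun j => (h2 j).summable)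
  simp only [(h1 _).tsum_eq, (h2 _).tsum_eq] at h3
  rw [lambertSeries, ← tsum_mul_left, ← h3]

theorem analyticAt_lambertSeries {q t : K} (hq : ‖q‖ < 1) (ht : ‖t‖ < 1) :
    AnalyticAt K (lambertSeries q) t := by
  have h1 : AnalyticAt K (fun x : K => ∑' j : ℕ, 1 / (1 - q ^ (j + 1)) * x ^ j) t := by
    refine analyticAt_tsum_mul_pow (fun j => ?_) ht
    rw [norm_div, norm_one, norm_one_sub_eq_one, div_one]
    rw [norm_pow]
    exact pow_lt_one₀ (norm_nonneg _) hq (Nat.succ_ne_zero j)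
  refine (analyticAt_id.mul h1).congr ?_
  filter_upwards [continuous_norm.continuousAt.eventually_lt continuousAt_const ht] with x hx
  exact (lambertSeries_eq_tsum hq hx).symm

/-- After finitely many rational terms are split off, the argument `q ^ M * t` lies in the unit
disc. -/
theorem meromorphicAt_lambertSeries {q : K} (hq : ‖q‖ < 1) (t : K) :
    MeromorphicAt (lambertSeries q) t := by
  have h := ((tendsto_pow_atTop_nhds_zero_of_norm_lt_one hq).mul_const t).norm
  rw [zero_mul, norm_zero] at h
  obtain ⟨M, hM⟩ := (h.eventually_lt_const one_pos).exists
  have h1 : MeromorphicAt (fun x => lambertSeries q (q ^ M * x)) t :=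
    ((analyticAt_lambertSeries hq hM).fun_comp (g := lambertSeries q) (f := fun x => q ^ M * x)
      (by fun_prop)).meromorphicAt
  have h2 : MeromorphicAt (fun x => ∑ m ∈ Finset.range M, geom (q ^ m * x)) t := by
    refine MeromorphicAt.fun_sum fun m _ => ?_
    unfold geom
    fun_prop
  refine (h2.add h1).congr (Eventually.of_forall fun x => ?_)
  exact (lambertSeries_eq_add hq x M).symm

/-- For negative indices, `1 / (1 - q ^ (-m) * u) = -geom (q ^ m / u)`. -/
theorem lambertZeta_eq {q u : K} (hq : ‖q‖ < 1) (hq0 : q ≠ 0) (hu : u ≠ 0) :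
    lambertZeta q u = lambertSeries q u - lambertSeries q (q * u⁻¹) := by
  refine HasSum.tsum_eq ?_
  rw [sub_eq_add_neg]
  refine HasSum.of_nat_of_neg_add_one ?_ ?_
  · refine (summable_geom_nat hq u).hasSum.congr_fun fun m => ?_
    simp [lambertTerm]
  · refine (summable_geom_nat hq (q * u⁻¹)).hasSum.neg.congr_fun fun m => ?_
    have h0 : ¬0 ≤ -((m : ℤ) + 1) := by omega
    have hz : q ^ (m + 1) ≠ 0 := pow_ne_zero _ hq0
    rw [lambertTerm, if_neg h0, geom, ← mul_assoc, ← pow_succ, zpow_neg]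
    norm_cast
    generalize q ^ (m + 1) = z at *
    rcases eq_or_ne z u with rfl | h
    · simp [hu]
    have h1 : u - z ≠ 0 := sub_ne_zero.2 h.symm
    rw [show 1 - z * u⁻¹ = (u - z) / u by field_simp, show 1 - z⁻¹ * u = -(u - z) / z by
        field_simp; ring]
    field_simp

theorem meromorphicAt_lambertZeta {q u : K} (hq : ‖q‖ < 1) (hq0 : q ≠ 0) (hu : u ≠ 0) :
    MeromorphicAt (lambertZeta q) u := by
  have h1 : MeromorphicAt (fun x => lambertSeries q (q * x⁻¹)) u :=
    (meromorphicAt_lambertSeries hq _).comp_analyticAt (g := fun x => q * x⁻¹)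
      (analyticAt_const.mul (analyticAt_id.inv hu))
  refine ((meromorphicAt_lambertSeries hq u).sub h1).congr ?_
  filter_upwards [eventually_ne_nhdsWithin (b := (0 : K)) hu] with x hx
  exact (lambertZeta_eq hq hq0 hx).symm

end

/-! ### Periodicity, zeros and poles of the theta quotient -/

section

variable {K : Type u} [NontriviallyNormedField K]

theorem norm_pow_lt_one {q : K} (hq : ‖q‖ < 1) {n : ℕ} (hn : 2 ≤ n) : ‖q ^ n‖ < 1 := by
  rw [norm_pow]
  exact pow_lt_one₀ (norm_nonneg _) hq (by omega)

theorem thetaQuotient_root_mul {q : K} (hq0 : q ≠ 0) {n : ℕ} (hn : 2 ≤ n) {ζ : K}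
    (hζ : ζ ^ n = 1) (u : K) : thetaQuotient q n (ζ * u) = ζ⁻¹ * thetaQuotient q n u := by
  rw [thetaQuotient_eq hq0 hn, thetaQuotient_eq hq0 hn, mul_pow, hζ, one_mul, mul_assoc ζ,
    mul_comm ζ, ← div_div, div_eq_mul_inv _ ζ, mul_comm]

/-- Otherwise `q ^ (1 + a * n) = q ^ (b * n)`; as `q` is not a root of unity, `n` would divide `1`.
-/
theorem not_zero_and_pole {q : K} (hq : ‖q‖ < 1) (hq0 : q ≠ 0) {n : ℕ} (hn : 2 ≤ n) {u : K}
    (h1 : ∃ m : ℤ, (u / q ^ m) ^ n = q) (h2 : ∃ m : ℤ, (u / q ^ m) ^ n = 1) : False := by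
  obtain ⟨a, ha⟩ := h1
  obtain ⟨b, hb⟩ := h2
  have hza : (q ^ a) ^ n ≠ 0 := pow_ne_zero n (zpow_ne_zero a hq0)
  have hzb : (q ^ b) ^ n ≠ 0 := pow_ne_zero n (zpow_ne_zero b hq0)
  rw [div_pow, div_eq_iff hza] at ha
  rw [div_pow, div_eq_iff hzb, one_mul, ha] at hb
  have h3 : q ^ (1 + a * n - b * n : ℤ) = 1 := by
    rw [zpow_sub₀ hq0, zpow_add₀ hq0, zpow_one, zpow_mul, zpow_mul, zpow_natCast, zpow_natCast, hb,
      div_self hzb]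
  refine zpow_ne_one hq hq0 (fun h => ?_) h3
  have h4 : (n : ℤ) * (b - a) = 1 := by linear_combination -h
  have h5 := Int.eq_one_or_neg_one_of_mul_eq_one h4
  omega

variable [IsUltrametricDist K] [CompleteSpace K]

/-- The automorphy factors of numerator and denominator differ by `q`, which the factor `u` in the
denominator absorbs. -/
theorem thetaQuotient_mul_left {q : K} (hq : ‖q‖ < 1) (hq0 : q ≠ 0) {n : ℕ} (hn : 2 ≤ n) {u : K}
    (hu : u ≠ 0) : thetaQuotient q n (q * u) = thetaQuotient q n u := by
  have hQ := norm_pow_lt_one hq hn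
  have hQ0 : q ^ n ≠ 0 := pow_ne_zero n hq0
  have hu0 : u ^ n ≠ 0 := pow_ne_zero n hu
  rw [thetaQuotient_eq hq0 hn, thetaQuotient_eq hq0 hn, mul_pow, mul_div_assoc,
    theta_mul hQ hQ0 (div_ne_zero hu0 hq0), theta_mul hQ hQ0 hu0]
  generalize theta (q ^ n) (u ^ n / q) = x
  generalize theta (q ^ n) (u ^ n) = y
  generalize q ^ n = a at *
  generalize u ^ n = b at *
  rcases eq_or_ne y 0 with rfl | hy
  · simp
  field_simp

theorem thetaQuotient_zpow_mul {q : K} (hq : ‖q‖ < 1) (hq0 : q ≠ 0) {n : ℕ} (hn : 2 ≤ n) {u : K}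
    (hu : u ≠ 0) (m : ℤ) : thetaQuotient q n (q ^ m * u) = thetaQuotient q n u := by
  induction m using Int.induction_on with
  | zero => rw [zpow_zero, one_mul]
  | succ m ih =>
    rw [zpow_add_one₀ hq0, mul_comm (q ^ (m : ℤ)), mul_assoc,
      thetaQuotient_mul_left hq hq0 hn (mul_ne_zero (zpow_ne_zero _ hq0) hu), ih]
  | pred m ih =>
    rw [← ih, ← thetaQuotient_mul_left hq hq0 hn (mul_ne_zero (zpow_ne_zero (-m - 1) hq0) hu),
      ← mul_assoc, ← zpow_one_add₀ hq0, add_sub_cancel]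

theorem eventually_norm_theta_pow_of_ne {Q b u₀ : K} (hQ : ‖Q‖ < 1) (hQ0 : Q ≠ 0) (hb : b ≠ 0)
    (hu₀ : u₀ ≠ 0) {n : ℕ} (h : theta Q (u₀ ^ n / b) ≠ 0) :
    ∀ᶠ u in 𝓝 u₀, ‖theta Q (u ^ n / b)‖ = ‖theta Q (u₀ ^ n / b)‖ := by
  have hc : ContinuousAt (fun u : K => u ^ n / b) u₀ := by fun_prop
  exact hc.eventually (eventually_norm_theta_of_ne hQ hQ0 (div_ne_zero (pow_ne_zero n hu₀) hb) h)

/-- The poles are isolated, since near `u₀` the norm of `theta (q ^ n) (u ^ n)` is either a nonzero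
constant or a multiple of `‖u - u₀‖`. -/
theorem eventually_zpow_mul_pow_ne_one {q : K} (hq : ‖q‖ < 1) (hq0 : q ≠ 0) {n : ℕ} (hn : 2 ≤ n)
    (hnK : (n : K) ≠ 0) {u₀ : K} (hu₀ : u₀ ≠ 0) :
    ∀ᶠ u in 𝓝[≠] u₀, ∀ m : ℤ, (q ^ m * u) ^ n ≠ 1 := by
  have hQ := norm_pow_lt_one hq hn
  have hQ0 : q ^ n ≠ 0 := pow_ne_zero n hq0
  have key : ∀ᶠ u in 𝓝[≠] u₀, theta (q ^ n) (u ^ n / 1) ≠ 0 := by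
    by_cases h : theta (q ^ n) (u₀ ^ n / 1) = 0
    · obtain ⟨C, hC, h1⟩ := eventually_norm_theta_pow hQ hQ0 one_ne_zero hu₀ hnK h
      filter_upwards [h1.filter_mono nhdsWithin_le_nhds, self_mem_nhdsWithin] with u h2 h3
      rw [← norm_pos_iff, h2]
      exact mul_pos hC (norm_pos_iff.2 (sub_ne_zero.2 h3))
    · filter_upwards [(eventually_norm_theta_pow_of_ne hQ hQ0 one_ne_zero hu₀ h).filter_mono
        nhdsWithin_le_nhds] with u h2
      rw [← norm_pos_iff, h2]
      exact norm_pos_iff.2 h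
  filter_upwards [key, eventually_ne_nhdsWithin (b := (0 : K)) hu₀] with u h hu m hm
  refine h ?_
  rw [div_one, theta_eq_zero_iff hQ hQ0 (pow_ne_zero n hu)]
  refine ⟨-m, ?_⟩
  rw [mul_pow, ← zpow_natCast (q ^ m) n, ← zpow_mul, mul_comm m, zpow_mul, zpow_natCast] at hm
  rw [zpow_neg]
  exact eq_inv_of_mul_eq_one_right hm

/-- Norm estimates alone do not give meromorphy; it comes from the expansion in Lambert zeta
functions, valid off the isolated poles. -/
theorem meromorphicAt_thetaQuotient {q : K} (hq : ‖q‖ < 1) (hq0 : q ≠ 0) {n : ℕ} (hn : 2 ≤ n)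
    (hnK : (n : K) ≠ 0) {ζ : K} (hζ : IsPrimitiveRoot ζ n) {u₀ : K} (hu₀ : u₀ ≠ 0) :
    MeromorphicAt (thetaQuotient q n) u₀ := by
  have hζ0 : ζ ≠ 0 := hζ.ne_zero (by omega)
  have h : MeromorphicAt (fun u => kroneckerConst (q ^ n) q / n *
      ∑ i ∈ Finset.range n, ζ ^ i * lambertZeta q (ζ ^ i * u)) u₀ := by
    refine (MeromorphicAt.const _ _).fun_mul (MeromorphicAt.fun_sum fun i _ =>
      (MeromorphicAt.const _ _).fun_mul ?_)
    exact (meromorphicAt_lambertZeta hq hq0 (mul_ne_zero (pow_ne_zero i hζ0) hu₀)).comp_analyticAt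
      (g := fun u => ζ ^ i * u) (by fun_prop)
  refine h.congr ?_
  filter_upwards [eventually_zpow_mul_pow_ne_one hq hq0 hn hnK hu₀,
    eventually_ne_nhdsWithin (b := (0 : K)) hu₀] with u h1 h2
  exact (thetaQuotient_eq_sum hq hq0 hn hnK hζ h2 h1).symm

theorem theta_numerator_eq_zero_iff {q : K} (hq : ‖q‖ < 1) (hq0 : q ≠ 0) {n : ℕ} (hn : 2 ≤ n)
    {u : K} (hu : u ≠ 0) :
    theta (q ^ n) (u ^ n / q) = 0 ↔ ∃ m : ℤ, (u / q ^ m) ^ n = q := by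
  rw [theta_eq_zero_iff (norm_pow_lt_one hq hn) (pow_ne_zero n hq0)
    (div_ne_zero (pow_ne_zero n hu) hq0)]
  refine exists_congr fun m => ?_
  have hz : (q ^ n) ^ m = (q ^ m) ^ n := by
    rw [← zpow_natCast (q ^ m) n, ← zpow_mul, mul_comm m, zpow_mul, zpow_natCast]
  have h0 : (q ^ m) ^ n ≠ 0 := pow_ne_zero n (zpow_ne_zero m hq0)
  rw [hz, div_pow, div_eq_iff hq0, div_eq_iff h0, mul_comm]

theorem theta_denominator_eq_zero_iff {q : K} (hq : ‖q‖ < 1) (hq0 : q ≠ 0) {n : ℕ} (hn : 2 ≤ n)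
    {u : K} (hu : u ≠ 0) :
    theta (q ^ n) (u ^ n) = 0 ↔ ∃ m : ℤ, (u / q ^ m) ^ n = 1 := by
  rw [theta_eq_zero_iff (norm_pow_lt_one hq hn) (pow_ne_zero n hq0) (pow_ne_zero n hu)]
  refine exists_congr fun m => ?_
  have hz : (q ^ n) ^ m = (q ^ m) ^ n := by
    rw [← zpow_natCast (q ^ m) n, ← zpow_mul, mul_comm m, zpow_mul, zpow_natCast]
  have h0 : (q ^ m) ^ n ≠ 0 := pow_ne_zero n (zpow_ne_zero m hq0)
  rw [hz, div_pow, div_eq_iff h0, one_mul]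

theorem meromorphicOrderAt_thetaQuotient {q : K} (hq : ‖q‖ < 1) (hq0 : q ≠ 0) {n : ℕ} (hn : 2 ≤ n)
    (hnK : (n : K) ≠ 0) {ζ : K} (hζ : IsPrimitiveRoot ζ n) {u₀ : K} (hu₀ : u₀ ≠ 0) :
    ((∃ m : ℤ, (u₀ / q ^ m) ^ n = q) → meromorphicOrderAt (thetaQuotient q n) u₀ = 1) ∧
    ((∃ m : ℤ, (u₀ / q ^ m) ^ n = 1) →
      meromorphicOrderAt (thetaQuotient q n) u₀ = ((-1 : ℤ) : WithTop ℤ)) ∧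
    ((¬∃ m : ℤ, (u₀ / q ^ m) ^ n = q) → (¬∃ m : ℤ, (u₀ / q ^ m) ^ n = 1) →
      meromorphicOrderAt (thetaQuotient q n) u₀ = 0) := by
  have hQ := norm_pow_lt_one hq hn
  have hQ0 : q ^ n ≠ 0 := pow_ne_zero n hq0
  have hun : 0 < ‖u₀‖ := norm_pos_iff.2 hu₀
  have hu := eventually_norm_eq continuousAt_id hu₀
  have hmer := meromorphicAt_thetaQuotient hq hq0 hn hnK hζ hu₀
  have heq : ∀ u, ‖thetaQuotient q n u‖ =
      ‖theta (q ^ n) (u ^ n / q)‖ / (‖u‖ * ‖theta (q ^ n) (u ^ n / 1)‖) := fun u => by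
    rw [thetaQuotient_eq hq0 hn, norm_div, norm_mul, div_one]
  have hnum := theta_numerator_eq_zero_iff hq hq0 hn hu₀
  have hden := theta_denominator_eq_zero_iff hq hq0 hn hu₀
  rw [← div_one (u₀ ^ n)] at hden
  refine ⟨fun h1 => ?_, fun h2 => ?_, fun h1 h2 => ?_⟩
  · have h2 : theta (q ^ n) (u₀ ^ n / 1) ≠ 0 := fun h2 =>
      not_zero_and_pole hq hq0 hn h1 (hden.1 h2)
    obtain ⟨C, hC, hC'⟩ := eventually_norm_theta_pow hQ hQ0 hq0 hu₀ hnK (hnum.2 h1)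
    have hD := norm_pos_iff.2 h2
    refine meromorphicOrderAt_eq_of_norm (e := 1) hmer
      (show 0 < C / (‖u₀‖ * ‖theta (q ^ n) (u₀ ^ n / 1)‖) by positivity)
      (Eventually.filter_mono nhdsWithin_le_nhds ?_)
    filter_upwards [hu, hC', eventually_norm_theta_pow_of_ne hQ hQ0 one_ne_zero hu₀ h2]
      with u e1 e2 e3
    rw [id, id] at e1
    rw [heq, e1, e2, e3, zpow_one]
    ring
  · have h1 : theta (q ^ n) (u₀ ^ n / q) ≠ 0 := fun h1 =>
      not_zero_and_pole hq hq0 hn (hnum.1 h1) h2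
    obtain ⟨C, hC, hC'⟩ := eventually_norm_theta_pow hQ hQ0 one_ne_zero hu₀ hnK (hden.2 h2)
    have hD := norm_pos_iff.2 h1
    refine meromorphicOrderAt_eq_of_norm (e := -1) hmer
      (show 0 < ‖theta (q ^ n) (u₀ ^ n / q)‖ / (‖u₀‖ * C) by positivity)
      (Eventually.filter_mono nhdsWithin_le_nhds ?_)
    filter_upwards [hu, hC', eventually_norm_theta_pow_of_ne hQ hQ0 hq0 hu₀ h1]
      with u e1 e2 e3
    rw [id, id] at e1
    rw [heq, e1, e2, e3, zpow_neg_one, ← mul_assoc, div_mul_eq_div_div, div_eq_mul_inv _ ‖u - u₀‖]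
  · have h1' := fun h => h1 (hnum.1 h)
    have h2' := fun h => h2 (hden.1 h)
    have hD1 := norm_pos_iff.2 h1'
    have hD2 := norm_pos_iff.2 h2'
    refine meromorphicOrderAt_eq_of_norm (e := 0) hmer
      (show 0 < ‖theta (q ^ n) (u₀ ^ n / q)‖ / (‖u₀‖ * ‖theta (q ^ n) (u₀ ^ n / 1)‖) by positivity)
      (Eventually.filter_mono nhdsWithin_le_nhds ?_)
    filter_upwards [hu, eventually_norm_theta_pow_of_ne hQ hQ0 one_ne_zero hu₀ h2',
      eventually_norm_theta_pow_of_ne hQ hQ0 hq0 hu₀ h1'] with u e1 e2 e3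
    rw [id, id] at e1
    rw [heq, e1, e2, e3, zpow_zero, mul_one]

end

/-! ### Tate coordinates and base change to `L` -/

/-- The constant `∑ m ≥ 1, m * q ^ m / (1 - q ^ m)` in the Tate uniformization. -/
noncomputable def eisensteinSum {K : Type u} [NontriviallyNormedField K] (q : K) : K :=
  ∑' m : ℕ+, ((m : ℕ) : K) * (q ^ (m : ℕ) / (1 - q ^ (m : ℕ)))

theorem tateX_eq {K : Type u} [NontriviallyNormedField K] (q u : K) :
    tateX q u = sumX q u - 2 * eisensteinSum q := rfl

theorem tateY_eq {K : Type u} [NontriviallyNormedField K] (q u : K) :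
    tateY q u = sumY q u + eisensteinSum q := rfl

theorem sumX_zpow_mul {K : Type u} [NontriviallyNormedField K] {q : K} (hq0 : q ≠ 0) (m : ℤ)
    (u : K) : sumX q (q ^ m * u) = sumX q u := by
  rw [sumX, sumX, ← (Equiv.addRight m).tsum_eq fun l : ℤ => geomX (q ^ l * u)]
  refine tsum_congr fun l => ?_
  rw [Equiv.coe_addRight, zpow_add₀ hq0, mul_assoc]

theorem tateX_zpow_mul {K : Type u} [NontriviallyNormedField K] {q : K} (hq0 : q ≠ 0) (m : ℤ)
    (u : K) : tateX q (q ^ m * u) = tateX q u := by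
  rw [tateX_eq, tateX_eq, sumX_zpow_mul hq0]

section BaseChange

theorem map_kroneckerConst {k : Type u} [NontriviallyNormedField k] [CompleteSpace k]
    (L : Type u) [NontriviallyNormedField L] [NormedAlgebra k L] {Q : k} (hQ : ‖Q‖ < 1) (b : k) :
    algebraMap k L (kroneckerConst Q b) =
      kroneckerConst (algebraMap k L Q) (algebraMap k L b) := by
  have h := multipliable_one_sub_succ hQ (1 : k)
  simp only [mul_one] at h
  have hc := continuous_algebraMap k L
  rw [kroneckerConst, kroneckerConst, theta, theta, map_div₀, map_neg, map_mul, map_pow,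
    (multipliable_one_sub_succ hQ _).map_tprod _ hc, (multipliable_one_sub hQ _).map_tprod _ hc,
    h.map_tprod _ hc]
  simp

theorem map_geom {k : Type u} [NontriviallyNormedField k] (L : Type u)
    [NontriviallyNormedField L] [NormedAlgebra k L] (t : k) :
    algebraMap k L (geom t) = geom (algebraMap k L t) := by
  simp [geom]

theorem map_geomX {k : Type u} [NontriviallyNormedField k] (L : Type u)
    [NontriviallyNormedField L] [NormedAlgebra k L] (t : k) :
    algebraMap k L (geomX t) = geomX (algebraMap k L t) := by
  simp [geomX]

variable {k : Type u} [NontriviallyNormedField k] [CompleteSpace k] [IsUltrametricDist k]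

theorem summable_eisensteinSum {q : k} (hq : ‖q‖ < 1) :
    Summable fun m : ℕ+ => ((m : ℕ) : k) * (q ^ (m : ℕ) / (1 - q ^ (m : ℕ))) := by
  have h := (summable_geom_nat hq 1).comp_injective PNat.coe_injective
  rw [NonarchimedeanAddGroup.summable_iff_tendsto_cofinite_zero] at *
  refine squeeze_zero_norm (fun m => ?_) (tendsto_zero_iff_norm_tendsto_zero.1 h)
  simp only [Function.comp, mul_one, geom]
  rw [norm_mul]
  exact mul_le_of_le_one_left (norm_nonneg _) (IsUltrametricDist.norm_natCast_le_one k m)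

variable (L : Type u) [NontriviallyNormedField L] [NormedAlgebra k L]

theorem map_sumX {q : k} (hq : ‖q‖ < 1) (v : k) :
    algebraMap k L (sumX q v) = sumX (algebraMap k L q) (algebraMap k L v) := by
  rw [sumX, (summable_geomX hq).map_tsum _ (continuous_algebraMap k L)]
  exact tsum_congr fun m => by simp [map_geomX]

theorem map_eisensteinSum {q : k} (hq : ‖q‖ < 1) :
    algebraMap k L (eisensteinSum q) = eisensteinSum (algebraMap k L q) := by
  rw [eisensteinSum, (summable_eisensteinSum hq).map_tsum _ (continuous_algebraMap k L)]
  exact tsum_congr fun m => by simp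

theorem map_tateX {q : k} (hq : ‖q‖ < 1) (v : k) :
    algebraMap k L (tateX q v) = tateX (algebraMap k L q) (algebraMap k L v) := by
  rw [tateX_eq, tateX_eq, map_sub, map_mul, map_sumX L hq, map_eisensteinSum L hq, map_ofNat]

theorem map_additionSlope {q v : k} (hq : ‖q‖ < 1) (hq0 : q ≠ 0) (hv : v ≠ 0)
    (hv1 : ∀ m : ℤ, q ^ m * v ≠ 1) :
    algebraMap k L (additionSlope q v) =
      additionSlope (algebraMap k L q) (algebraMap k L v) := by
  rw [additionSlope, (summable_additionSlope hq hq0 hv hv1).map_tsum _ (continuous_algebraMap k L)]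
  exact tsum_congr fun m => by simp [map_geom]

theorem map_additionConst {q : k} (hq : ‖q‖ < 1) (v : k) :
    algebraMap k L (additionConst q v) =
      additionConst (algebraMap k L q) (algebraMap k L v) := by
  rw [additionConst, (summable_additionConst hq).map_tsum _ (continuous_algebraMap k L)]
  exact tsum_congr fun m => by simp [map_geomX]

end BaseChange

/-! ### The theta quotient as a fraction in `x` and `y` -/

section Rationality

open Polynomial

variable {k : Type u} [NontriviallyNormedField k]

/-- The denominator `∏ (X - x (ζ ^ i))` of the theta quotient. -/
noncomputable def denominator (q ζ : k) (n : ℕ) : k[X] :=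
  ∏ i ∈ Finset.Ico 1 n, (X - C (tateX q (ζ ^ i)))

/-- The product of the factors of `denominator` other than `X - x (ζ ^ i)`. -/
noncomputable def cofactor (q ζ : k) (n i : ℕ) : k[X] :=
  ∏ j ∈ (Finset.Ico 1 n).erase i, (X - C (tateX q (ζ ^ j)))

/-- The part of degree `0` in `Y` of the numerator of the theta quotient. -/
noncomputable def numeratorConst (q ζ : k) (n : ℕ) : k[X] :=
  C (kroneckerConst (q ^ n) q / n) * ∑ i ∈ Finset.Ico 1 n, C (ζ ^ i) *
    (C (eisensteinSum q) + C (additionSlope q (ζ ^ i)) * (X + C (2 * eisensteinSum q)) +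
      C (additionConst q (ζ ^ i))) * cofactor q ζ n i

/-- The coefficient of `Y` in the numerator of the theta quotient. -/
noncomputable def numeratorLinear (q ζ : k) (n : ℕ) : k[X] :=
  C (kroneckerConst (q ^ n) q / n) * ∑ i ∈ Finset.Ico 1 n, C (-ζ ^ i) * cofactor q ζ n i

theorem denominator_ne_zero (q ζ : k) (n : ℕ) : denominator q ζ n ≠ 0 :=
  (monic_prod_X_sub_C _ _).ne_zero

theorem sum_Ico_pow {n : ℕ} (hn : 2 ≤ n) {ζ : k} (hζ : IsPrimitiveRoot ζ n) :
    ∑ i ∈ Finset.Ico 1 n, ζ ^ i = -1 := by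
  have h := hζ.geom_sum_eq_zero (by omega)
  rw [Finset.range_eq_Ico, Finset.sum_eq_sum_Ico_succ_bot (by omega), pow_zero, zero_add] at h
  linear_combination h

/-- Each cofactor is monic of degree `n - 2`, and `∑ -ζ ^ i = 1` over `0 < i < n`. This coefficient
shows that the numerator is not zero. -/
theorem coeff_numeratorLinear (q : k) {n : ℕ} (hn : 2 ≤ n) {ζ : k} (hζ : IsPrimitiveRoot ζ n) :
    (numeratorLinear q ζ n).coeff (n - 2) = kroneckerConst (q ^ n) q / n := by
  have hc : ∀ i ∈ Finset.Ico 1 n, (cofactor q ζ n i).coeff (n - 2) = 1 := by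
    intro i hi
    have hd : (cofactor q ζ n i).natDegree = n - 2 := by
      rw [cofactor, natDegree_finsetProd_X_sub_C_eq_card, Finset.card_erase_of_mem hi,
        Nat.card_Ico, Nat.sub_sub]
    rw [← hd]
    exact monic_prod_X_sub_C _ _
  rw [numeratorLinear, coeff_C_mul, finsetSum_coeff, Finset.sum_congr rfl (g := fun i => -ζ ^ i),
    Finset.sum_neg_distrib, sum_Ico_pow hn hζ, neg_neg, mul_one]
  intro i hi
  rw [coeff_C_mul, hc i hi, mul_one]

variable [CompleteSpace k] [IsUltrametricDist k]

/-- The theta quotient is a rational function of `x` and `y`. -/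
theorem thetaQuotient_mul_denominator {q : k} (hq : ‖q‖ < 1) (hq0 : q ≠ 0) {n : ℕ} (hn : 2 ≤ n)
    (hnk : (n : k) ≠ 0) {ζ : k} (hζ : IsPrimitiveRoot ζ n)
    (L : Type u) [NontriviallyNormedField L] [CompleteSpace L] [IsUltrametricDist L]
    [NormedAlgebra k L] {u : L} (hu : u ≠ 0) (hu1 : ∀ m : ℤ, u ≠ algebraMap k L q ^ m)
    (hden : aeval (tateX (algebraMap k L q) u) (denominator q ζ n) ≠ 0) :
    thetaQuotient (algebraMap k L q) n u *
        aeval (tateX (algebraMap k L q) u) (denominator q ζ n) =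
      aeval (tateX (algebraMap k L q) u) (numeratorConst q ζ n) +
        aeval (tateX (algebraMap k L q) u) (numeratorLinear q ζ n) *
          tateY (algebraMap k L q) u := by
  have hq' : ‖algebraMap k L q‖ < 1 := by rwa [norm_algebraMap']
  have hq0' : algebraMap k L q ≠ 0 := (_root_.map_ne_zero _).2 hq0
  have hζ' : IsPrimitiveRoot (algebraMap k L ζ) n := hζ.map_of_injective (algebraMap k L).injective
  have hnL : (n : L) ≠ 0 := by
    rw [← map_natCast (algebraMap k L)]
    exact (_root_.map_ne_zero _).2 hnk
  have hζ0 : ζ ≠ 0 := hζ.ne_zero (by omega)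
  have hζ0' : algebraMap k L ζ ≠ 0 := (_root_.map_ne_zero _).2 hζ0
  have : NeZero n := ⟨by omega⟩
  have hne : ∀ i ∈ Finset.Ico 1 n,
      tateX (algebraMap k L q) u - tateX (algebraMap k L q) (algebraMap k L ζ ^ i) ≠ 0 := by
    intro i hi h
    refine hden ?_
    rw [denominator, map_prod]
    refine Finset.prod_eq_zero hi ?_
    rw [map_sub, aeval_X, aeval_C, map_tateX L hq, map_pow, h]
  -- A pole would be `u = ζ ^ i * q ^ (-m)`. The case `i = 0` is excluded by `hu1`; for `i > 0`,
  -- `x(u) = x(ζ ^ i)` would make the denominator vanish.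
  have hpole : ∀ m : ℤ, (algebraMap k L q ^ m * u) ^ n ≠ 1 := by
    intro m hm
    obtain ⟨i, hin, hi⟩ := hζ'.eq_pow_of_pow_eq_one hm
    rcases Nat.eq_zero_or_pos i with rfl | hi0
    · refine hu1 (-m) ?_
      rw [zpow_neg]
      exact eq_inv_of_mul_eq_one_right (by rw [← hi, pow_zero])
    · refine hne i (Finset.mem_Ico.2 ⟨hi0, hin⟩) ?_
      rw [hi, tateX_zpow_mul hq0', sub_self]
  have hroot : ∀ i, (algebraMap k L ζ ^ i) ^ n = 1 := fun i => by
    rw [← pow_mul, mul_comm, pow_mul, hζ'.pow_eq_one, one_pow]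
  have hv : ∀ i ∈ Finset.Ico 1 n, ∀ m : ℤ, q ^ m * ζ ^ i ≠ 1 := by
    intro i hi m hm
    rw [Finset.mem_Ico] at hi
    have h1 : q ^ (m * n) = 1 := by
      have h2 : (q ^ m * ζ ^ i) ^ n = 1 := by rw [hm, one_pow]
      rwa [mul_pow, ← pow_mul, mul_comm i, pow_mul, hζ.pow_eq_one, one_pow, mul_one,
        ← zpow_natCast, ← zpow_mul] at h2
    have h3 : m = 0 := by
      by_contra h
      exact zpow_ne_one hq hq0 (mul_ne_zero h (by omega)) h1
    rw [h3, zpow_zero, one_mul] at hm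
    exact hζ.pow_ne_one_of_pos_of_lt (by omega) hi.2 hm
  have hv' : ∀ i ∈ Finset.Ico 1 n, ∀ m : ℤ,
      algebraMap k L q ^ m * algebraMap k L ζ ^ i ≠ 1 := by
    intro i hi m hm
    refine hv i hi m ((algebraMap k L).injective ?_)
    rw [map_mul, map_zpow₀, map_pow, hm, map_one]
  have hadd : ∀ i ∈ Finset.Ico 1 n,
      (lambertZeta (algebraMap k L q) (algebraMap k L ζ ^ i * u) -
        lambertZeta (algebraMap k L q) u) *
        (tateX (algebraMap k L q) u - tateX (algebraMap k L q) (algebraMap k L ζ ^ i)) =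
      algebraMap k L (eisensteinSum q) + algebraMap k L (additionSlope q (ζ ^ i)) *
        (tateX (algebraMap k L q) u + algebraMap k L (2 * eisensteinSum q)) +
        algebraMap k L (additionConst q (ζ ^ i)) - tateY (algebraMap k L q) u := by
    intro i hi
    have h := lambertZeta_sub_mul_sumX_sub hq' hq0' hu (pow_ne_zero i hζ0')
      (fun m hm => hpole m (by rw [hm, one_pow])) (hv' i hi)
      (fun m hm => hpole m (by
        have h2 : (algebraMap k L q ^ m * (algebraMap k L ζ ^ i * u)) ^ n = 1 := by
          rw [hm, one_pow]
        rwa [mul_left_comm, mul_pow, hroot, one_mul] at h2))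
    rw [map_additionSlope L hq hq0 (pow_ne_zero i hζ0) (hv i hi), map_additionConst L hq, map_mul,
      map_eisensteinSum L hq, map_pow, tateX_eq, tateX_eq, tateY_eq, map_ofNat]
    linear_combination h
  -- Since `∑ ζ ^ i = -1` over `0 < i < n`, subtracting `Z(u)` from each of these terms accounts for
  -- the term `i = 0`.
  have hf : thetaQuotient (algebraMap k L q) n u =
      algebraMap k L (kroneckerConst (q ^ n) q / n) * ∑ i ∈ Finset.Ico 1 n,
        algebraMap k L ζ ^ i * (lambertZeta (algebraMap k L q) (algebraMap k L ζ ^ i * u) -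
        lambertZeta (algebraMap k L q) u) := by
    rw [thetaQuotient_eq_sum hq' hq0' hn hnL hζ' hu hpole, map_div₀,
      map_kroneckerConst L (norm_pow_lt_one hq hn), map_pow, map_natCast]
    congr 1
    simp only [mul_sub]
    rw [Finset.sum_sub_distrib, ← Finset.sum_mul, sum_Ico_pow hn hζ', Finset.range_eq_Ico,
      Finset.sum_eq_sum_Ico_succ_bot (by omega), pow_zero, zero_add, one_mul, one_mul]
    ring
  have hnum : ∀ (c : k) (g : ℕ → k[X]), aeval (tateX (algebraMap k L q) u)
      (C c * ∑ i ∈ Finset.Ico 1 n, g i) =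
      algebraMap k L c * ∑ i ∈ Finset.Ico 1 n, aeval (tateX (algebraMap k L q) u) (g i) :=
    fun c g => by rw [map_mul, aeval_C, map_sum]
  rw [hf, numeratorConst, numeratorLinear, hnum, hnum, mul_assoc, mul_assoc, ← mul_add,
    Finset.sum_mul, Finset.sum_mul, ← Finset.sum_add_distrib]
  congr 1
  refine Finset.sum_congr rfl fun i hi => ?_
  have hfac : aeval (tateX (algebraMap k L q) u) (denominator q ζ n) =
      (tateX (algebraMap k L q) u - tateX (algebraMap k L q) (algebraMap k L ζ ^ i)) *
        aeval (tateX (algebraMap k L q) u) (cofactor q ζ n i) := by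
    rw [denominator, ← Finset.mul_prod_erase _ _ hi, map_mul, map_sub, aeval_X, aeval_C,
      map_tateX L hq, map_pow]
    rfl
  rw [hfac]
  simp only [map_mul, map_add, aeval_C, aeval_X, map_neg, map_pow]
  have h := hadd i hi
  rw [map_mul] at h
  linear_combination (algebraMap k L ζ ^ i *
    aeval (tateX (algebraMap k L q) u) (cofactor q ζ n i)) * h

end Rationality

/-! ### The subgroup of roots of unity and the character -/

section Group

variable {k : Type u} [NontriviallyNormedField k]

theorem mem_rootsOfUnityImage_iff {q : kˣ} {n : ℕ} {g : kˣ} :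
    (g : TatePoints q) ∈ rootsOfUnityImage q n ↔
      ∃ ξ : kˣ, ξ ^ n = 1 ∧ ∃ m : ℤ, g = ξ * q ^ m := by
  rw [rootsOfUnityImage, Subgroup.mem_map]
  constructor
  · rintro ⟨ξ, hξ, h⟩
    obtain ⟨m, hm⟩ := Subgroup.mem_zpowers_iff.1 (QuotientGroup.eq.1 h)
    exact ⟨ξ, hξ, m, by rw [hm, mul_inv_cancel_left]⟩
  · rintro ⟨ξ, hξ, m, rfl⟩
    refine ⟨ξ, hξ, QuotientGroup.eq.2 ?_⟩
    rw [inv_mul_cancel_left]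
    exact Subgroup.mem_zpowers_iff.2 ⟨m, rfl⟩

/-- No nontrivial power of `q` is a root of unity, so the image in `kˣ / q ^ ℤ` still has all the
roots as distinct elements. -/
theorem bijective_subgroupMap_rootsOfUnity {q : kˣ} (hq : ‖(q : k)‖ < 1) {n : ℕ} (hn : n ≠ 0) :
    Function.Bijective
      ((QuotientGroup.mk' (Subgroup.zpowers q)).subgroupMap (rootsOfUnity n k)) := by
  refine ⟨?_, MonoidHom.subgroupMap_surjective _ _⟩
  rw [injective_iff_map_eq_one]
  rintro ⟨ξ, hξ⟩ h
  have h1 : (ξ : TatePoints q) = 1 := congrArg Subtype.val h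
  obtain ⟨m, rfl⟩ := Subgroup.mem_zpowers_iff.1 ((QuotientGroup.eq_one_iff _).1 h1)
  have h2 : (q : k) ^ (m * n) = 1 := by
    have h3 : (q ^ m) ^ n = 1 := hξ
    rw [← zpow_natCast, ← zpow_mul] at h3
    have h4 := congrArg Units.val h3
    rwa [Units.val_zpow_eq_zpow_val, Units.val_one] at h4
  have h3 : m = 0 := by
    by_contra h
    exact zpow_ne_one hq q.ne_zero (mul_ne_zero h (by exact_mod_cast hn)) h2
  ext
  simp [h3]

/-- The isomorphism of the group of `n`-th roots of unity with its image on the Tate curve. -/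
noncomputable def rootsOfUnityEquiv {q : kˣ} (hq : ‖(q : k)‖ < 1) {n : ℕ} (hn : n ≠ 0) :
    rootsOfUnity n k ≃* rootsOfUnityImage q n :=
  MulEquiv.ofBijective _ (bijective_subgroupMap_rootsOfUnity hq hn)

/-- The character of the theta quotient, which sends the image of a root of unity to its
inverse. -/
noncomputable def thetaCharacter {q : kˣ} (hq : ‖(q : k)‖ < 1) {n : ℕ} (hn : n ≠ 0) :
    rootsOfUnityImage q n →* kˣ :=
  ((rootsOfUnity n k).subtype.comp (rootsOfUnityEquiv hq hn).symm.toMonoidHom)⁻¹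

theorem thetaCharacter_mk {q : kˣ} (hq : ‖(q : k)‖ < 1) {n : ℕ} (hn : n ≠ 0) {ξ : kˣ}
    (hξ : ξ ^ n = 1) (m : ℤ) (h : ((ξ * q ^ m : kˣ) : TatePoints q) ∈ rootsOfUnityImage q n) :
    thetaCharacter hq hn ⟨((ξ * q ^ m : kˣ) : TatePoints q), h⟩ = ξ⁻¹ := by
  have h1 : (⟨((ξ * q ^ m : kˣ) : TatePoints q), h⟩ : rootsOfUnityImage q n) =
      rootsOfUnityEquiv hq hn ⟨ξ, hξ⟩ := by
    refine Subtype.ext (QuotientGroup.eq.2 ?_)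
    exact Subgroup.mem_zpowers_iff.2 ⟨-m, by simp⟩
  rw [thetaCharacter, MonoidHom.inv_apply, MonoidHom.comp_apply, h1]
  simp

end Group

/-! ### The theta quotient in the function field -/

section Numerator

open Polynomial WeierstrassCurve.Affine

theorem mk_denominator_ne_zero {k : Type u} [NontriviallyNormedField k]
    (W : WeierstrassCurve.Affine k) (q ζ : k) (n : ℕ) :
    CoordinateRing.mk W (C (denominator q ζ n)) ≠ 0 := by
  intro h
  refine denominator_ne_zero q ζ n (CoordinateRing.smul_basis_eq_zero (W' := W) (q := 0) ?_).1
  rw [zero_smul, add_zero, CoordinateRing.smul, mul_one, h]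

variable {k : Type u} [NontriviallyNormedField k] [CompleteSpace k] [IsUltrametricDist k]

/-- The coordinate ring is free over `k[X]` on `1` and `Y`, so it suffices that the coefficient of
`Y` is nonzero. -/
theorem mk_numerator_ne_zero (W : WeierstrassCurve.Affine k) {q : k} (hq : ‖q‖ < 1) (hq0 : q ≠ 0)
    {n : ℕ} (hn : 2 ≤ n) (hnk : (n : k) ≠ 0) {ζ : k} (hζ : IsPrimitiveRoot ζ n) :
    CoordinateRing.mk W (C (numeratorConst q ζ n) + C (numeratorLinear q ζ n) * X) ≠ 0 := by
  intro h
  rw [map_add, map_mul] at h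
  have h1 := (CoordinateRing.smul_basis_eq_zero (W' := W) (p := numeratorConst q ζ n)
    (q := numeratorLinear q ζ n) (by
      rw [CoordinateRing.smul, CoordinateRing.smul, mul_one, h])).2
  have h2 := coeff_numeratorLinear q hn hζ
  rw [h1, coeff_zero] at h2
  exact div_ne_zero (kroneckerConst_ne_zero (norm_pow_lt_one hq hn) (norm_pow_lt_norm hq hq0 hn) hq
    (pow_ne_zero n hq0)) hnk h2.symm

/-- The theta quotient as an element of the function field of the Tate curve. -/
noncomputable def thetaFunction (q : kˣ) (ζ : k) (n : ℕ) : TateFunctionField q :=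
  algebraMap (tateCurve q).toAffine.CoordinateRing (TateFunctionField q)
      (CoordinateRing.mk (tateCurve q).toAffine
        (C (numeratorConst (q : k) ζ n) + C (numeratorLinear (q : k) ζ n) * X)) /
    algebraMap (tateCurve q).toAffine.CoordinateRing (TateFunctionField q)
      (CoordinateRing.mk (tateCurve q).toAffine (C (denominator (q : k) ζ n)))

theorem thetaFunction_ne_zero {q : kˣ} (hq : ‖(q : k)‖ < 1) {n : ℕ} (hn : 2 ≤ n)
    (hnk : (n : k) ≠ 0) {ζ : k} (hζ : IsPrimitiveRoot ζ n) : thetaFunction q ζ n ≠ 0 := by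
  have hinj := IsFractionRing.injective (tateCurve q).toAffine.CoordinateRing (TateFunctionField q)
  refine div_ne_zero ?_ ?_
  · exact (map_ne_zero_iff _ hinj).2 (mk_numerator_ne_zero _ hq q.ne_zero hn hnk hζ)
  · exact (map_ne_zero_iff _ hinj).2 (mk_denominator_ne_zero _ _ _ _)

end Numerator

/-! ### The Jacobi property -/

section Main

theorem natCast_ne_zero_of_algebra {k L : Type*} [Field k] [Field L] [Algebra k L] {n : ℕ}
    (hnk : (n : k) ≠ 0) : (n : L) ≠ 0 := by
  rw [← map_natCast (algebraMap k L)]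
  exact (map_ne_zero _).2 hnk

/-- Extending `k` to `L` adds no `n`-th roots of unity, since `k` already has a primitive one. Poles
are the case `q₀ = 1`; zeros are the case where `q₀` is an `n`-th root of `q`. -/
theorem exists_eq_root_mul_zpow {k L : Type*} [Field k] [Field L] [Algebra k L] {q : kˣ} {n : ℕ}
    {ζ : k} (hn : 2 ≤ n) (hζ : IsPrimitiveRoot ζ n) (q₀ : kˣ) {u : L} {m : ℤ}
    (h : (u / algebraMap k L q ^ m) ^ n = algebraMap k L (q₀ ^ n : kˣ)) :
    ∃ ξ : kˣ, ξ ^ n = 1 ∧ u = algebraMap k L (ξ * q₀ : kˣ) * algebraMap k L q ^ m := by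
  have : NeZero n := ⟨by omega⟩
  have hq0 : algebraMap k L q ≠ 0 := (map_ne_zero _).2 q.ne_zero
  have hq₀ : algebraMap k L q₀ ≠ 0 := (map_ne_zero _).2 q₀.ne_zero
  have h1 : (u / algebraMap k L q ^ m / algebraMap k L q₀) ^ n = 1 := by
    rw [div_pow, h, Units.val_pow_eq_pow_val, map_pow, div_self (pow_ne_zero n hq₀)]
  obtain ⟨i, -, hi⟩ :=
    (hζ.map_of_injective (algebraMap k L).injective).eq_pow_of_pow_eq_one h1
  obtain ⟨z, rfl⟩ := hζ.isUnit (by omega)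
  refine ⟨z ^ i, Units.ext ?_, ?_⟩
  · rw [← pow_mul, mul_comm, pow_mul, Units.val_pow_eq_pow_val, Units.val_pow_eq_pow_val,
      hζ.pow_eq_one, one_pow, Units.val_one]
  · rw [Units.val_mul, Units.val_pow_eq_pow_val, map_mul, map_pow, hi, div_mul_cancel₀ _ hq₀,
      div_mul_cancel₀ _ (zpow_ne_zero m hq0)]

variable {k : Type u} [NontriviallyNormedField k] [CompleteSpace k] [IsUltrametricDist k]
  {q : kˣ} {n : ℕ} {ζ : k} (L : Type u) [NontriviallyNormedField L] [CompleteSpace L]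
  [IsUltrametricDist L] [NormedAlgebra k L]

theorem isTatePullback_thetaFunction (hq : ‖(q : k)‖ < 1) (hn : 2 ≤ n) (hnk : (n : k) ≠ 0)
    (hζ : IsPrimitiveRoot ζ n) :
    IsTatePullback q (thetaFunction q ζ n) L (thetaQuotient (algebraMap k L q) n) := by
  have hq' : ‖algebraMap k L q‖ < 1 := by rwa [norm_algebraMap']
  have hq0' : algebraMap k L q ≠ 0 := (map_ne_zero _).2 q.ne_zero
  refine ⟨fun u => meromorphicAt_thetaQuotient hq' hq0' hn (natCast_ne_zero_of_algebra hnk)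
    (hζ.map_of_injective (algebraMap k L).injective) u.ne_zero, _, _,
    mk_denominator_ne_zero _ _ _ _, rfl, fun u hu hden => ?_⟩
  rw [Polynomial.aevalAeval_C] at hden
  rw [eq_div_iff (by rwa [Polynomial.aevalAeval_C]), map_add, map_mul, Polynomial.aevalAeval_C,
    Polynomial.aevalAeval_C, Polynomial.aevalAeval_C, Polynomial.aevalAeval_Y]
  exact thetaQuotient_mul_denominator hq q.ne_zero hn hnk hζ L u.ne_zero hu hden

theorem isJacobiFunction_thetaFunction (hq : ‖(q : k)‖ < 1) (hn : 2 ≤ n) (hnk : (n : k) ≠ 0)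
    (hζ : IsPrimitiveRoot ζ n) :
    IsJacobiFunction q (rootsOfUnityImage q n) (thetaCharacter hq (show n ≠ 0 by omega))
      (thetaFunction q ζ n) := by
  have hn0 : n ≠ 0 := by omega
  have : NeZero n := ⟨hn0⟩
  refine ⟨Finite.of_equiv _ (rootsOfUnityEquiv hq hn0).toEquiv, ?_,
    thetaFunction_ne_zero hq hn hnk hζ, ?_⟩
  · rwa [← Nat.card_congr (rootsOfUnityEquiv hq hn0).toEquiv, hζ.card_rootsOfUnity]
  intro L _ _ _ _
  have hq' : ‖algebraMap k L q‖ < 1 := by rwa [norm_algebraMap']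
  have hq0' : algebraMap k L q ≠ 0 := (map_ne_zero _).2 q.ne_zero
  have hord := fun u : Lˣ => meromorphicOrderAt_thetaQuotient hq' hq0' hn
    (natCast_ne_zero_of_algebra hnk) (hζ.map_of_injective (algebraMap k L).injective) u.ne_zero
  refine ⟨thetaQuotient (algebraMap k L q) n, isTatePullback_thetaFunction L hq hn hnk hζ,
    fun u => ?_, fun u hu => ?_, fun g hg u => ?_⟩
  · obtain ⟨h1, h2, h3⟩ := hord u
    by_cases hz : ∃ m : ℤ, ((u : L) / algebraMap k L q ^ m) ^ n = algebraMap k L q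
    · rw [h1 hz]
      exact_mod_cast (by norm_num : (-1 : ℤ) ≤ 1)
    · by_cases hp : ∃ m : ℤ, ((u : L) / algebraMap k L q ^ m) ^ n = 1
      · rw [h2 hp]
      · rw [h3 hz hp]
        exact_mod_cast (by norm_num : (-1 : ℤ) ≤ 0)
  · obtain ⟨h1, h2, h3⟩ := hord u
    by_cases hz : ∃ m : ℤ, ((u : L) / algebraMap k L q ^ m) ^ n = algebraMap k L q
    · rw [h1 hz]
      exact zero_le_one
    · rw [h3 hz]
      rintro ⟨m, hm⟩
      obtain ⟨ξ, hξ, h⟩ := exists_eq_root_mul_zpow (q := q) (u := (u : L)) (m := m) hn hζ 1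
        (by rw [one_pow, Units.val_one, map_one, hm])
      refine hu (ξ * q ^ m) (mem_rootsOfUnityImage_iff.2 ⟨ξ, hξ, m, rfl⟩) ?_
      rw [h]
      simp
  · obtain ⟨ξ, hξ, m, rfl⟩ := mem_rootsOfUnityImage_iff.1 hg
    rw [thetaCharacter_mk hq hn0 hξ]
    filter_upwards [eventually_ne_nhdsWithin (b := (0 : L)) u.ne_zero] with w hw
    have hξ' : algebraMap k L ξ ^ n = 1 := by
      rw [← map_pow, ← Units.val_pow_eq_pow_val, hξ, Units.val_one, map_one]
    rw [Units.val_mul, Units.val_zpow_eq_zpow_val, map_mul, map_zpow₀, mul_assoc,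
      thetaQuotient_root_mul hq0' hn hξ', thetaQuotient_zpow_mul hq' hq0' hn hw,
      Units.val_inv_eq_inv_val, map_inv₀]

end Main

end TateUniformization

theorem theorem6 {k : Type u} [NontriviallyNormedField k] [CompleteSpace k] [IsUltrametricDist k]
    (n : ℕ) (hn : 2 ≤ n) (hnk : (n : k) ≠ 0) (hζ : ∃ ζ : k, IsPrimitiveRoot ζ n)
    (q : kˣ) (hq : ‖(q : k)‖ < 1) (hq₀ : ∃ q₀ : kˣ, q₀ ^ n = q) :
    ∃ (χ : rootsOfUnityImage q n →* kˣ) (F : TateFunctionField q),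
      IsJacobiFunction q (rootsOfUnityImage q n) χ F ∧
      ∀ (L : Type u) [NontriviallyNormedField L] [CompleteSpace L] [IsUltrametricDist L]
        [NormedAlgebra k L],
        IsTatePullback q F L (thetaQuotient (algebraMap k L q) n) ∧
        ∀ u : Lˣ,
          (0 < meromorphicOrderAt (thetaQuotient (algebraMap k L q) n) (u : L) ↔
            ∃ r : kˣ, r ^ n = q ∧ ∃ m : ℤ, (u : L) = algebraMap k L r * algebraMap k L q ^ m) ∧
          (0 < meromorphicOrderAt (thetaQuotient (algebraMap k L q) n) (u : L) →
            meromorphicOrderAt (thetaQuotient (algebraMap k L q) n) (u : L) = 1) := by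
  obtain ⟨ζ, hζ⟩ := hζ
  obtain ⟨q₀, hq₀⟩ := hq₀
  refine ⟨_, _, TateUniformization.isJacobiFunction_thetaFunction hq hn hnk hζ,
    fun L _ _ _ _ => ⟨TateUniformization.isTatePullback_thetaFunction L hq hn hnk hζ, fun u => ?_⟩⟩
  have hq' : ‖algebraMap k L q‖ < 1 := by rwa [norm_algebraMap']
  have hq0' : algebraMap k L q ≠ 0 := (map_ne_zero _).2 q.ne_zero
  obtain ⟨h1, h2, h3⟩ := TateUniformization.meromorphicOrderAt_thetaQuotient hq' hq0' hn
    (TateUniformization.natCast_ne_zero_of_algebra hnk)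
    (hζ.map_of_injective (algebraMap k L).injective) u.ne_zero
  have hzero : 0 < meromorphicOrderAt (thetaQuotient (algebraMap k L q) n) (u : L) →
      ∃ m : ℤ, ((u : L) / algebraMap k L q ^ m) ^ n = algebraMap k L q := by
    intro h
    by_contra hz
    by_cases hp : ∃ m : ℤ, ((u : L) / algebraMap k L q ^ m) ^ n = 1
    · rw [h2 hp] at h
      exact absurd h (by decide)
    · rw [h3 hz hp] at h
      exact lt_irrefl _ h
  refine ⟨⟨fun h => ?_, ?_⟩, fun h => h1 (hzero h)⟩
  · obtain ⟨m, hm⟩ := hzero h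
    obtain ⟨ξ, hξ, h⟩ := TateUniformization.exists_eq_root_mul_zpow (q := q) (m := m) hn hζ q₀
      (by rw [hq₀, hm])
    exact ⟨ξ * q₀, by rw [mul_pow, hξ, one_mul, hq₀], m, h⟩
  · rintro ⟨r, hr, m, hu⟩
    rw [h1 ⟨m, ?_⟩]
    · exact zero_lt_one
    · rw [hu, mul_div_cancel_right₀ _ (zpow_ne_zero m hq0'), ← hr, Units.val_pow_eq_pow_val,
        map_pow]
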